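/- **Setting.** Let $N\ge 1$, $\mathcal S=\{1,\dots,N\}\cup\{\bar 1,\dots,\bar N\}$, and put $\operatorname{sg}(k)=1$, $\operatorname{sg}(\bar k)=-1$. The slow variables are $(s,t)$ with $s=(s_a)_{a\in\mathcal S}\in\mathbb R^{\mathcal S}$, $\sum_a s_a=0$, and $t=(t_{ja})_{j\ge 1,a\in\mathcal S}$, $t_{ja}\in\mathbb C$; they equal $\epsilon$ times the fast variables. Let $D$ be a set of $(s,t)$ that is open in $s$ and any single $t_{ja}$ jointly. For $\epsilon\in(0,\epsilon_0)$ let $$S=\mathbb I+\varphi_1(n)\Lambda^{-1}+\varphi_2(n)\Lambda^{-2}+\cdots,\qquad \bar S=\bar\varphi_0(n)+\bar\varphi_1(n)\Lambda+\cdots$$ (formal series in the shift $(\Lambda f)(n)=f(n+1)$, with $N\times N$ matrix coefficients depending on $n\in\mathbb Z$ and on $\epsilon,s,t$) solve on $D$, at the points with $s\in\epsilon\mathbb Z^{\mathcal S}$, the factorization problem $S W_0 g=\bar S\bar W_0$ of the multicomponent 2D Toda hierarchy, where $$W_0=\sum_kE_{kk}\Lambda^{s_k/\epsilon}e^{\sum_{j\ge1}t_{jk}\Lambda^j/\epsilon},\qquad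 \bar W_0=\sum_kE_{kk}\Lambda^{-s_{\bar k}/\epsilon}e^{\sum_{j\ge1}t_{j\bar k}\Lambda^{-j}/\epsilon}$$ and $g$ does not depend on $(s,t)$. Here $\bar\varphi_0(n)$ is invertible, the coefficients are differentiable in each $t_{ja}$, and, the series being formal, the constancy of $g=W^{-1}\bar W$ for $W=SW_0$, $\bar W=\bar S\bar W_0$ means that $\epsilon\partial_{ja}W\cdot W^{-1}=\epsilon\partial_{ja}\bar W\cdot\bar W^{-1}$, with $\partial_{ja}=\partial/\partial t_{ja}$, for all $j,a$, and $T(W)W^{-1}=T(\bar W)\bar W^{-1}$ for all the shifts $T=T_{(a,b)}\colon s_a\mapsto s_a+\epsilon,\ s_b\mapsto s_b-\epsilon$ that stay in $D$. (In $\epsilon\partial_{ja}W\cdot W^{-1}=\epsilon\partial_{ja}S\cdot S^{-1}+S(\epsilon\partial_{ja}W_0\cdot W_0^{-1})S^{-1}$, and likewise for the other terms, all products are well defined.) Fix $n_0\in\mathbb Z$, $a_0\in\mathcal S\setminus\{1\}$ and $\bar a_0\in\mathcal S\setminus\{\bar1\}$. Let $\mathsf T_a=T_{(a,1)}$ for $a\ne1$,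 $\mathsf T_1=T_{(1,a_0)}$, $\bar{\mathsf T}_a=T_{(a,\bar1)}$ for $a\neq\bar1$, $\bar{\mathsf T}_{\bar1}=T_{(\bar1,\bar a_0)}$, and let $\partial_a,\bar\partial_a$ be the corresponding derivatives in $s$: $\partial_a=\partial_{s_a}-\partial_{s_1}$ $(a\neq1)$, $\partial_1=\partial_{s_1}-\partial_{s_{a_0}}$, $\bar\partial_a=\partial_{s_a}-\partial_{s_{\bar1}}$ $(a\ne\bar1)$, $\bar\partial_{\bar1}=\partial_{s_{\bar1}}-\partial_{s_{\bar a_0}}$. For $a\in\mathcal S$ let $(A_{a,i})_{i\ge0}$ be the first-row coefficients at $n=n_0$: $1,\varphi_{1,11},\varphi_{2,11},\dots$ for $a=1$; $\varphi_{1,1k},\varphi_{2,1k},\dots$ for $a=k\ne1$; $\bar\varphi_{0,1k},\bar\varphi_{1,1k},\dots$ for $a=\bar k$. Put $$\mathcal L_a=\mathcal K_a\mathsf T_a\mathcal K_a^{-1},\quad \mathcal K_a=\sum_{i\ge0}A_{a,i}\mathsf T_a^{-i},\qquad \bar{\mathcal L}_a=\bar{\mathcal K}_a\bar{\mathsf T}_a\bar{\mathcal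 K}_a^{-1},\quad \bar{\mathcal K}_a=\sum_{i\ge0}A_{a,i}\bar{\mathsf T}_a^{-i}.$$ The projection $(\cdot)_+$ sends $\sum_ic_i\mathsf T_a^i$ to $\sum_{i\ge0}c_i\mathsf T_a^i$ if $a=1$ and to $\sum_{i>0}c_i\mathsf T_a^i$ if $a\ne1$; it sends $\sum_ic_i\bar{\mathsf T}_a^i$ to $\sum_{i\ge0}c_i\bar{\mathsf T}_a^i$ if $a=1$, to $\sum_{i>0}c_i\bar{\mathsf T}_a^i$ if $a=\bar1$ and $\bar a_0=1$, and to $\sum_{i>0}c_i(\bar{\mathsf T}_a^i-1)$ otherwise. **Quasi-classical ansatz.** With $\zeta_b=z^{\operatorname{sg}(b)}$, $\nu_b=1$ for $b\in\{2,\dots,N\}$ and $\nu_b=0$ otherwise, let $$\mathcal T_b=(\epsilon n_0+\operatorname{sg}(b)s_b-\epsilon\nu_b)\log z+\sum_{j\ge1}t_{jb}\zeta_b^{\,j}.$$ Assume that on all of $D$ the wave functions $\Psi_b=e^{\mathcal T_b/\epsilon}\sum_{i\ge0}A_{b,i}\zeta_b^{-i}$ (entries at $n_0$ of the first rows of $W(z^n)$,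 $\bar W(z^n)$) are of the form $\Psi_b=\exp(\mathscr S_b/\epsilon)$, where $\mathscr S_b-\mathcal T_b$ is a formal power series in $\zeta_b^{-1}$, without constant term if $b=1$, whose coefficients are differentiable in each $t_{ja}$, and that $\mathscr S_b=\mathscr S_{b,0}+\epsilon\mathscr S_{b,1}+\cdots$ coefficientwise: each coefficient has, as $\epsilon\to0^+$, an asymptotic expansion in powers of $\epsilon$ with smooth coefficients, locally uniform in $s$ and any single $t_{ja}$. **Proposition (Hamilton–Jacobi equations).** For all $j\ge1$, $a\in\mathcal S$ and $(s,t)\in D$ the coefficients of $(\mathcal L_a^j)_+$ and of $(\bar{\mathcal L}_a^j)_+$ converge as $\epsilon\to0^+$, say to $P_{ja,i}$ and $\bar P_{ja,i}$ (coefficients of the $i$-th powers of the shifts). The polynomials $\mathscr P_{ja}(Z)=\sum_iP_{ja,i}Z^i$ and $\bar{\mathscr P}_{ja}(Z)=\sum_i\bar P_{ja,i}Z^i$, of degree at most $j$, have the form $$\mathscr P_{j1}(Z)=Z^j+P_{j1,j-1}Z^{j-1}+\dots+P_{j1,0},\qquad \mathscr P_{ja}(Z)=P_{ja,j}Z^j+\dots+P_{ja,1}Z\quad(a\ne1),$$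 $$\bar{\mathscr P}_{j1}(Z)=Z^j+\bar P_{j1,j-1}Z^{j-1}+\dots+\bar P_{j1,0},\qquad \bar{\mathscr P}_{j\bar1}(Z)=\sum_{i=1}^j\bar P_{j\bar1,i}Z^i\quad\text{if }\bar a_0=1,$$ $$\bar{\mathscr P}_{ja}(Z)=\sum_{i=1}^j\bar P_{ja,i}(Z^i-1)\quad\text{if }a\neq1\text{ and }(a,\bar a_0)\ne(\bar1,1),$$ and for every $b\in\mathcal S$ the leading term $\mathscr S_{b,0}$ is differentiable and satisfies on $D$, as identities of formal Laurent series in $\zeta_b^{-1}$, $$\partial_{ja}\mathscr S_{b,0}=\mathscr P_{ja}\big(e^{\partial_a\mathscr S_{b,0}}\big),\qquad \partial_{ja}\mathscr S_{b,0}=\bar{\mathscr P}_{ja}\big(e^{\bar\partial_a\mathscr S_{b,0}}\big).$$ -/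

import Mathlib

open Filter Topology Asymptotics
open scoped ContDiff

noncomputable section

namespace TodaWhitham

/-! ### Indices, charges and times -/

/-- The index set `𝒮 = {1,…,N} ∪ {1̄,…,N̄}`: `inl k` is the unbarred and `inr k` the barred index.
The distinguished indices `1` and `1̄` are `inl 0` and `inr 0`. -/
abbrev Idx (N : ℕ) : Type := Fin N ⊕ Fin N

/-- The zero charge sector `∑ₐ sₐ = 0`. -/
def ZeroCharge (N : ℕ) : Submodule ℝ (Idx N → ℝ) where
  carrier := {s | ∑ a, s a = 0}
  add_mem' := by
    intro s s' hs hs'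
    simp only [Set.mem_ofPred_eq, Pi.add_apply, Finset.sum_add_distrib] at *
    rw [hs, hs', add_zero]
  zero_mem' := by simp
  smul_mem' := by
    intro c s hs
    simp only [Set.mem_ofPred_eq, Pi.smul_apply, smul_eq_mul, ← Finset.mul_sum] at *
    rw [hs, mul_zero]

/-- The direction `e_a - e_b` of the charge preserving shift `T_(a,b)`. -/
def shiftVec {N : ℕ} (a b : Idx N) : ZeroCharge N :=
  ⟨Pi.single a 1 - Pi.single b 1, by
    change ∑ c, (Pi.single a (1 : ℝ) - Pi.single b 1 : Idx N → ℝ) c = 0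
    simp only [Pi.sub_apply, Finset.sum_sub_distrib, Finset.sum_pi_single', Finset.mem_univ,
      if_true, sub_self]⟩

/-- Slow variables `(s, t)`: charges `s_a` (real, of total charge zero) and times `t_{ja}`, `j ≥ 1`. -/
abbrev Slow (N : ℕ) : Type := ZeroCharge N × (ℕ+ × Idx N → ℂ)

/-- `(s, t) ↦ (s + r v, t)`. -/
def Slow.shift {N : ℕ} (x : Slow N) (v : ZeroCharge N) (r : ℝ) : Slow N := (x.1 + r • v, x.2)

/-- Replace the time `t_p` by `τ`. -/
def Slow.setTime {N : ℕ} (x : Slow N) (p : ℕ+ × Idx N) (τ : ℂ) : Slow N :=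
  (x.1, Function.update x.2 p τ)

/-- Replace the charges by `q.1` and the time `t_p` by `q.2`. -/
def Slow.move {N : ℕ} (x : Slow N) (p : ℕ+ × Idx N) (q : ZeroCharge N × ℂ) : Slow N :=
  (q.1, Function.update x.2 p q.2)

/-- `D` is open in the variables `s` and any single time. -/
def IsSlowOpen {N : ℕ} (D : Set (Slow N)) : Prop :=
  ∀ x ∈ D, ∀ p : ℕ+ × Idx N, ∀ᶠ q in 𝓝 (x.1, x.2 p), x.move p q ∈ D

/-- The fast charges `s_a / ε` are integers. -/
def OnLattice {N : ℕ} (ε : ℝ) (x : Slow N) : Prop :=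
  ∀ a : Idx N, ∃ m : ℤ, (x.1 : Idx N → ℝ) a = ε * m

/-! ### Difference operators in `n` with matrix coefficients -/

/-- A formal series `∑_j X_j(n) Λ^j`, where `X j n` is the coefficient `X_j(n)`. -/
abbrev DiffOp (N : ℕ) : Type := ℤ → ℤ → Matrix (Fin N) (Fin N) ℂ

/-- The product determined by `(X(n) Λ^i)(Y(n) Λ^j) = X(n) Y(n+i) Λ^{i+j}`. It is only used for two
series that are both bounded above, or both bounded below, in `Λ`, when all sums are finite. -/
def DiffOp.mul {N : ℕ} (X Y : DiffOp N) : DiffOp N :=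
  fun m n => ∑ᶠ i : ℤ, X i n * Y (m - i) (n + i)

/-- The identity operator. -/
def DiffOp.one (N : ℕ) : DiffOp N := fun m _ => if m = 0 then 1 else 0

/-- The operator `E_kk Λ^j`. -/
def DiffOp.unit {N : ℕ} (k : Fin N) (j : ℤ) : DiffOp N :=
  fun m _ => if m = j then Matrix.single k k 1 else 0

/-- The operator `∑_k E_kk Λ^{e k}`. -/
def DiffOp.diag {N : ℕ} (e : Fin N → ℤ) : DiffOp N :=
  fun m _ => Matrix.diagonal fun k => if m = e k then 1 else 0

/-- Membership in `G_-`: the operators `1 + ∑_{j<0} X_j(n) Λ^j`. -/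
def IsGMinus {N : ℕ} (X : DiffOp N) : Prop :=
  (∀ m n, 0 < m → X m n = 0) ∧ ∀ n, X 0 n = 1

/-- Membership in `G_+`: the invertible operators `∑_{j≥0} X_j(n) Λ^j`. -/
def IsGPlus {N : ℕ} (X : DiffOp N) : Prop :=
  (∀ m n, m < 0 → X m n = 0) ∧ ∀ n, IsUnit (X 0 n)

/-- `P S⁻¹ = P' S'⁻¹`, the inverse of `S ∈ G_-` being taken among the series in nonpositive powers of `Λ`
and that of `S' ∈ G_+` among the series in nonnegative powers. -/
def SameRatio {N : ℕ} (P S P' S' : DiffOp N) : Prop :=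
  ∃ R R' : DiffOp N,
    (∀ m n, 0 < m → R m n = 0) ∧ S.mul R = DiffOp.one N ∧ R.mul S = DiffOp.one N ∧
    (∀ m n, m < 0 → R' m n = 0) ∧ S'.mul R' = DiffOp.one N ∧ R'.mul S' = DiffOp.one N ∧
    P.mul R = P'.mul R'

/-- Coefficientwise partial derivative with respect to the time `t_p`. -/
def opTimeDeriv {N : ℕ} (S : Slow N → DiffOp N) (p : ℕ+ × Idx N) (x : Slow N) : DiffOp N :=
  fun m n => Matrix.of fun k l => deriv (fun τ => S (x.setTime p τ) m n k l) (x.2 p)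

/-- `∂_{ja} W₀ · W₀⁻¹` in the fast times, where `W₀ = ∑_k E_kk Λ^{s_k} exp(∑_j t_{jk} Λ^j)`. -/
def bareFlow {N : ℕ} (p : ℕ+ × Idx N) : DiffOp N :=
  match p.2 with
  | Sum.inl k => DiffOp.unit k (p.1 : ℕ)
  | Sum.inr _ => 0

/-- `∂_{ja} W̄₀ · W̄₀⁻¹` in the fast times, where `W̄₀ = ∑_k E_kk Λ^{-s_k̄} exp(∑_j t_{jk̄} Λ^{-j})`. -/
def bareFlowBar {N : ℕ} (p : ℕ+ × Idx N) : DiffOp N :=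
  match p.2 with
  | Sum.inl _ => 0
  | Sum.inr k => DiffOp.unit k (-((p.1 : ℕ) : ℤ))

/-- `T_(a,b)(W₀) · W₀⁻¹`. -/
def bareShift {N : ℕ} (a b : Idx N) : DiffOp N :=
  DiffOp.diag fun k => (if Sum.inl k = a then 1 else 0) - (if Sum.inl k = b then 1 else 0)

/-- `T_(a,b)(W̄₀) · W̄₀⁻¹`. -/
def bareShiftBar {N : ℕ} (a b : Idx N) : DiffOp N :=
  DiffOp.diag fun k => (if Sum.inr k = b then 1 else 0) - (if Sum.inr k = a then 1 else 0)

/-- `(S, S̄)` solves the factorization problem `S W₀ g = S̄ W̄₀` of the `N`-component 2D Toda hierarchy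
with an operator `g` that does not depend on the deformation parameters, in the slow variables
`(s, t) = ε · (fast variables)` ranging over `D`, the fast charges being integers.

The dressing operators `W = S W₀`, `W̄ = S̄ W̄₀` are doubly infinite series, whose products are not
defined without convergence assumptions. For formal series, `W g = W̄` with constant `g` therefore means
that all derivatives and shifts of `W⁻¹ W̄` are trivial:
`∂W · W⁻¹ = ∂W̄ · W̄⁻¹` for every (fast) time and `T(W) · W⁻¹ = T(W̄) · W̄⁻¹` for every shift `T = T_(a,b)`,
for example `∂_{jk}W · W⁻¹ = (ε ∂S/∂t_{jk} + S E_kk Λ^j) S⁻¹`. -/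
structure IsTodaSolution {N : ℕ} (ε : ℝ) (D : Set (Slow N)) (S Sbar : Slow N → DiffOp N) : Prop where
  minus : ∀ x ∈ D, OnLattice ε x → IsGMinus (S x)
  plus : ∀ x ∈ D, OnLattice ε x → IsGPlus (Sbar x)
  differentiable : ∀ x ∈ D, OnLattice ε x → ∀ p m n k l,
    DifferentiableAt ℂ (fun τ => S (x.setTime p τ) m n k l) (x.2 p) ∧
    DifferentiableAt ℂ (fun τ => Sbar (x.setTime p τ) m n k l) (x.2 p)
  flow : ∀ x ∈ D, OnLattice ε x → ∀ p,
    SameRatio (ε • opTimeDeriv S p x + (S x).mul (bareFlow p)) (S x)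
      (ε • opTimeDeriv Sbar p x + (Sbar x).mul (bareFlowBar p)) (Sbar x)
  shift : ∀ x ∈ D, OnLattice ε x → ∀ a b, x.shift (shiftVec a b) ε ∈ D →
    SameRatio ((S (x.shift (shiftVec a b) ε)).mul (bareShift a b)) (S x)
      ((Sbar (x.shift (shiftVec a b) ε)).mul (bareShiftBar a b)) (Sbar x)

/-! ### Formal phases and wave functions

Everything attached to the index `b` is expanded in the local variable `ζ = z^{sg b}`, that is
`ζ = z` (with `z → ∞`) for unbarred `b` and `ζ = z⁻¹` (with `z → 0`) for barred `b`. -/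

/-- A formal expression `log · log ζ + ∑_{m ∈ ℤ} coeff m · ζ^m`. -/
structure Phase where
  log : ℂ
  coeff : ℤ → ℂ

/-- The exponential `e^{f(0)} exp(f - f(0))` of a power series. -/
def expSeries (f : PowerSeries ℂ) : PowerSeries ℂ :=
  PowerSeries.C (Complex.exp (PowerSeries.constantCoeff f)) *
    (PowerSeries.exp ℂ).subst (f - PowerSeries.C (PowerSeries.constantCoeff f))

/-- `E = exp(p)`, where `E` is a Laurent series in `ζ⁻¹` and `p = d log ζ + ∑_{i ≥ 0} p_{-i} ζ^{-i}`
with `d` an integer. -/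
def Phase.IsExp (E : LaurentSeries ℂ) (p : Phase) : Prop :=
  ∃ d : ℤ, p.log = d ∧ (∀ m, 0 < m → p.coeff m = 0) ∧
    E = HahnSeries.single (-d) 1 *
      HahnSeries.ofPowerSeries ℤ ℂ (expSeries (PowerSeries.mk fun i : ℕ => p.coeff (-(i : ℤ))))

/-- `p` has no logarithm and equals the Laurent series `L` in `ζ⁻¹`. -/
def Phase.IsSeries (L : LaurentSeries ℂ) (p : Phase) : Prop :=
  p.log = 0 ∧ ∀ m, p.coeff m = L.coeff (-m)

/-- `p` is the partial derivative of the phase `F` with respect to the time `t_{ja}`. -/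
def HasTimeDeriv {N : ℕ} (F : Slow N → Phase) (j : ℕ+) (a : Idx N) (x : Slow N) (p : Phase) : Prop :=
  HasDerivAt (fun τ => (F (x.setTime (j, a) τ)).log) p.log (x.2 (j, a)) ∧
  ∀ m, HasDerivAt (fun τ => (F (x.setTime (j, a) τ)).coeff m) (p.coeff m) (x.2 (j, a))

/-- `p` is the derivative of the phase `F` with respect to the charges in the direction `v`. -/
def HasChargeDeriv {N : ℕ} (F : Slow N → Phase) (v : ZeroCharge N) (x : Slow N) (p : Phase) : Prop :=
  HasDerivAt (fun r : ℝ => (F (x.shift v r)).log) p.log 0 ∧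
  ∀ m, HasDerivAt (fun r : ℝ => (F (x.shift v r)).coeff m) (p.coeff m) 0

/-- `sg(a)`. -/
def sg {N : ℕ} : Idx N → ℤ
  | Sum.inl _ => 1
  | Sum.inr _ => -1

/-- `ν_a`. -/
def nu {N : ℕ} [NeZero N] : Idx N → ℤ
  | Sum.inl k => if k = 0 then 0 else 1
  | Sum.inr _ => 0

/-- The explicit part
`𝒯_b = (ε n₀ + sg(b) s_b - ε ν_b) log z + ∑_{j ≥ 1} t_{jb} z^{sg(b) j}` of the phase, as a phase in
`ζ = z^{sg b}`. -/
def barePhase {N : ℕ} [NeZero N] (n₀ : ℤ) (ε : ℝ) (b : Idx N) (x : Slow N) : Phase where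
  log := (((x.1 : Idx N → ℝ) b + ε * (sg b * (n₀ - nu b)) : ℝ) : ℂ)
  coeff m := if h : 0 < m then x.2 (⟨m.toNat, by omega⟩, b) else 0

/-- First row, at `n = n₀`, of the coefficients of `S = 1 + φ₁ Λ⁻¹ + ⋯` and `S̄ = φ̄₀ + φ̄₁ Λ + ⋯`:
the sequence `1, φ_{1,11}, φ_{2,11}, …` for `b = 1`; `φ_{1,1k}, φ_{2,1k}, …` for `b = k ≠ 1`;
`φ̄_{0,1k}, φ̄_{1,1k}, …` for `b = k̄`. Thus the wave function `Ψ_b`, the `b`-th entry of the first row of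
`W(z^n)` or `W̄(z^n)` at `n₀`, is `exp(𝒯_b / ε) · ∑_i amp b i ζ^{-i}`. -/
def amp {N : ℕ} [NeZero N] (n₀ : ℤ) (S Sbar : DiffOp N) (b : Idx N) (i : ℕ) : ℂ :=
  match b with
  | Sum.inl k => S (-(i : ℤ) - nu (Sum.inl k : Idx N)) n₀ 0 k
  | Sum.inr k => Sbar i n₀ 0 k

/-- `f_ε ∼ ∑_m ε^m c_m` as `ε → 0+`, with smooth `c_m`, locally uniformly in `s` and any single time. -/
def HasSlowExpansion {N : ℕ} (D : Set (Slow N)) (f : ℝ → Slow N → ℂ) (c : ℕ → Slow N → ℂ) : Prop :=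
  ∀ x ∈ D, ∀ p : ℕ+ × Idx N,
    (∀ m, ContDiffAt ℝ ∞ (fun q : ZeroCharge N × ℂ => c m (x.move p q)) (x.1, x.2 p)) ∧
    ∀ M : ℕ, (fun y : ℝ × (ZeroCharge N × ℂ) =>
        f y.1 (x.move p y.2) - ∑ m ∈ Finset.range M, (y.1 : ℂ) ^ m * c m (x.move p y.2))
      =O[𝓝[>] (0 : ℝ) ×ˢ 𝓝 (x.1, x.2 p)] fun y => y.1 ^ M

/-- The quasi-classical ansatz `Ψ_b = exp(𝒮_b / ε)`, `𝒮_b = 𝒮_{b,0} + ε 𝒮_{b,1} + ⋯`, with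
`𝒮_b = 𝒯_b +` a series in `ζ⁻¹`, without constant term if `b = 1`. Here `phase ε b = 𝒮_b` and
`term m b = 𝒮_{b,m}`. -/
structure IsQuasiClassical {N : ℕ} [NeZero N] (n₀ : ℤ) (ε₀ : ℝ) (D : Set (Slow N))
    (S Sbar : ℝ → Slow N → DiffOp N) (phase : ℝ → Idx N → Slow N → Phase)
    (term : ℕ → Idx N → Slow N → Phase) : Prop where
  log_eq : ∀ ε ∈ Set.Ioo 0 ε₀, ∀ x ∈ D, ∀ b, (phase ε b x).log = (barePhase n₀ ε b x).log
  coeff_eq : ∀ ε ∈ Set.Ioo 0 ε₀, ∀ x ∈ D, ∀ b, ∀ m : ℤ, 0 < m →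
    (phase ε b x).coeff m = (barePhase n₀ ε b x).coeff m
  coeff_zero : ∀ ε ∈ Set.Ioo 0 ε₀, ∀ x ∈ D, (phase ε (Sum.inl 0) x).coeff 0 = 0
  wave : ∀ ε ∈ Set.Ioo 0 ε₀, ∀ x ∈ D, ∀ b,
    Phase.IsExp
      (HahnSeries.ofPowerSeries ℤ ℂ (PowerSeries.mk fun i => amp n₀ (S ε x) (Sbar ε x) b i))
      { log := ((phase ε b x).log - (barePhase n₀ ε b x).log) / ε
        coeff := fun m => ((phase ε b x).coeff m - (barePhase n₀ ε b x).coeff m) / ε }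
  differentiable : ∀ ε ∈ Set.Ioo 0 ε₀, ∀ x ∈ D, ∀ b m p,
    DifferentiableAt ℂ (fun τ => (phase ε b (x.setTime p τ)).coeff m) (x.2 p)
  log_expansion : ∀ b, HasSlowExpansion D (fun ε x => (phase ε b x).log) fun m x => (term m b x).log
  coeff_expansion : ∀ b i,
    HasSlowExpansion D (fun ε x => (phase ε b x).coeff i) fun m x => (term m b x).coeff i

/-! ### Scalar shift operators and Lax operators -/

/-- A formal series `∑_m C_m T^m` in a shift operator `T`, with scalar coefficients `C m x`. -/
abbrev ShiftOp (N : ℕ) : Type := ℤ → Slow N → ℂ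

/-- Composition, where `(T f)(s, t) = f(s + ε v, t)`. It is only used for series that are bounded
above in `T`, when all sums are finite. -/
def ShiftOp.comp {N : ℕ} (ε : ℝ) (v : ZeroCharge N) (P Q : ShiftOp N) : ShiftOp N :=
  fun m x => ∑ᶠ i : ℤ, P i x * Q (m - i) (x.shift v (ε * i))

/-- The operator `T^i`. -/
def ShiftOp.single (N : ℕ) (i : ℤ) : ShiftOp N := fun m _ => if m = i then 1 else 0

/-- Powers with respect to composition. -/
def ShiftOp.pow {N : ℕ} (ε : ℝ) (v : ZeroCharge N) (P : ShiftOp N) : ℕ → ShiftOp N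
  | 0 => ShiftOp.single N 0
  | j + 1 => ShiftOp.comp ε v (ShiftOp.pow ε v P j) P

/-- The operator `∑_{i ≥ 0} A_i T^{-i}`. -/
def ShiftOp.ofSeq {N : ℕ} (A : ℕ → Slow N → ℂ) : ShiftOp N :=
  fun m x => if m ≤ 0 then A (-m).toNat x else 0

/-- The coefficients `A'_i` of the inverse `∑_{i ≥ 0} A'_i T^{-i}` of `∑_{i ≥ 0} A_i T^{-i}`, obtained by
solving `∑_{i ≤ m} A_i · T^{-i}(A'_{m-i}) = δ_{m0}` recursively. -/
def invSeq {N : ℕ} (ε : ℝ) (v : ZeroCharge N) (A : ℕ → Slow N → ℂ) : ℕ → Slow N → ℂ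
  | 0 => fun x => (A 0 x)⁻¹
  | m + 1 => fun x => -(A 0 x)⁻¹ *
      ∑ i : Fin (m + 1), A (m + 1 - i) x * invSeq ε v A i (x.shift v (-(ε * (m + 1 - i : ℕ))))
termination_by m => m
decreasing_by exact i.isLt

/-- The Lax operator `𝒦 ∘ T ∘ 𝒦⁻¹`, where `𝒦 = ∑_{i ≥ 0} A_i T^{-i}`. -/
def lax {N : ℕ} (ε : ℝ) (v : ZeroCharge N) (A : ℕ → Slow N → ℂ) : ShiftOp N :=
  ShiftOp.comp ε v (ShiftOp.comp ε v (ShiftOp.ofSeq A) (ShiftOp.single N 1))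
    (ShiftOp.ofSeq (invSeq ε v A))

/-- The direction of the unbarred shift `𝒯_a`, which is `T_(1,a₀)` if `a = 1` and `T_(a,1)` otherwise. -/
def dir {N : ℕ} [NeZero N] (a₀ a : Idx N) : ZeroCharge N :=
  if a = Sum.inl 0 then shiftVec a a₀ else shiftVec a (Sum.inl 0)

/-- The direction of the barred shift `𝒯̄_a`, which is `T_(1̄,a₀)` if `a = 1̄` and `T_(a,1̄)` otherwise. -/
def dirBar {N : ℕ} [NeZero N] (a₀ a : Idx N) : ZeroCharge N :=
  if a = Sum.inr 0 then shiftVec a a₀ else shiftVec a (Sum.inr 0)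

/-- `∑_{m ≥ 0} C_m T^m`. -/
def ShiftOp.nonneg {N : ℕ} (C : ShiftOp N) : ShiftOp N := fun m x => if 0 ≤ m then C m x else 0

/-- `∑_{m > 0} C_m T^m`. -/
def ShiftOp.pos {N : ℕ} (C : ShiftOp N) : ShiftOp N := fun m x => if 0 < m then C m x else 0

/-- `∑_{m > 0} C_m (T^m - 1)`. -/
def ShiftOp.posSubOne {N : ℕ} (C : ShiftOp N) : ShiftOp N := fun m x =>
  if 0 < m then C m x else if m = 0 then -∑ᶠ (i : ℤ) (_ : 0 < i), C i x else 0

/-- The projection `(·)_+` for the unbarred operators with index `a`. -/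
def plus {N : ℕ} [NeZero N] (a : Idx N) (C : ShiftOp N) : ShiftOp N :=
  if a = Sum.inl 0 then C.nonneg else C.pos

/-- The projection `(·)_+` for the barred operators with index `a`. -/
def plusBar {N : ℕ} [NeZero N] (a₀ a : Idx N) (C : ShiftOp N) : ShiftOp N :=
  if a = Sum.inl 0 then C.nonneg
  else if a = Sum.inr 0 ∧ a₀ = Sum.inl 0 then C.pos else C.posSubOne

/-- `(ℒ_a^j)_+` for the unbarred Lax operators of the family `(S_ε, S̄_ε)`, at `n = n₀`. -/
def laxPlus {N : ℕ} [NeZero N] (n₀ : ℤ) (a₀ : Idx N) (S Sbar : ℝ → Slow N → DiffOp N) (ε : ℝ)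
    (j : ℕ+) (a : Idx N) : ShiftOp N :=
  plus a (ShiftOp.pow ε (dir a₀ a)
    (lax ε (dir a₀ a) fun i x => amp n₀ (S ε x) (Sbar ε x) a i) j)

/-- `(ℒ̄_a^j)_+` for the barred Lax operators of the family `(S_ε, S̄_ε)`, at `n = n₀`. -/
def laxPlusBar {N : ℕ} [NeZero N] (n₀ : ℤ) (a₀ : Idx N) (S Sbar : ℝ → Slow N → DiffOp N) (ε : ℝ)
    (j : ℕ+) (a : Idx N) : ShiftOp N :=
  plusBar a₀ a (ShiftOp.pow ε (dirBar a₀ a)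
    (lax ε (dirBar a₀ a) fun i x => amp n₀ (S ε x) (Sbar ε x) a i) j)

/-- The polynomial whose coefficients are the limits of those of the operators `C_ε` at `x`. -/
def IsLimitSymbol {N : ℕ} (C : ℝ → ShiftOp N) (x : Slow N) (P : Polynomial ℂ) : Prop :=
  ∀ i : ℕ, Tendsto (fun ε => C ε i x) (𝓝[>] 0) (𝓝 (P.coeff i))

/-- The Hamilton–Jacobi equation `∂F/∂t_{ja} = P(exp(∂_v F))` at `x`, as an identity of Laurent series in
`ζ⁻¹`, the derivatives being part of the claim. -/
def HamiltonJacobi {N : ℕ} (F : Slow N → Phase) (j : ℕ+) (a : Idx N) (v : ZeroCharge N)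
    (P : Polynomial ℂ) (x : Slow N) : Prop :=
  ∃ (dt ds : Phase) (L E : LaurentSeries ℂ), HasTimeDeriv F j a x dt ∧ HasChargeDeriv F v x ds ∧
    dt.IsSeries L ∧ ds.IsExp E ∧ L = Polynomial.aeval E P

end TodaWhitham

end

noncomputable section

namespace TodaWhitham

/-! ### Exponentials of power series -/

/-! Write $v=e_a-e_c$ for the direction of the shift $T=T_{(a,c)}$; every shift in the theorem has
this form with $a\ne c$. At a lattice point the wave functions satisfy linear equations
$\epsilon\partial_{ja}\Psi_b=\sum_{i\le j}d_i\,T^i\Psi_b$ with the same coefficients $d_i$ for all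
$b$ (`IsTodaSolution.wave_equation`). The reason is the Riemann–Hilbert argument of the Toda
hierarchy. The operators $\epsilon\partial_{ja}W-\sum_i d_iT^i(W)$ and $\epsilon\partial_{ja}\bar
W-\sum_i d_iT^i(\bar W)$, stripped of $W_0$ and $\bar W_0$, have the same ratio to $S$ and $\bar S$.
If the first row at $n_0$ of one has only negative powers of $\Lambda$ and that of the other only
nonnegative ones, both rows vanish (`row_eq_zero`).

The conditions on $d$ are met by the coefficients of $(\mathcal L_a^j)_+$. The identity $\mathcal
L_a^j\mathcal K_a=\mathcal K_aT^j$, read in nonnegative powers of $T$, settles column $a$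
(`lax_pow_sum`). The first row of $S$ has leading entry $1$ in column $1$, and this fixes $d_0$: it
is the Lax coefficient if $a=1$, it vanishes if $c=1$, and otherwise $\sum_i d_i=0$. These are the
three projections, collected in `projCoeff`.

Substituting $\Psi_b=\exp(\mathscr S_b/\epsilon)$ and dividing by $\Psi_b$ gives
$\partial_{ja}\mathscr S_b=\sum_i d_i\exp\big((T^i\mathscr S_b-\mathscr S_b)/\epsilon\big)$
(`IsQuasiClassical.phase_equation`). It remains to let $\epsilon\to0^+$. The difference quotients
tend to $i\,\partial_v\mathscr S_{b,0}$ by the expansion to second order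
(`HasSlowExpansion.tendsto_dividedDifference`). The time derivatives converge by Weierstrass'
theorem for holomorphic functions (`HasSlowExpansion.tendsto_timeDeriv`). The Lax coefficients solve
a triangular system built from the exponentials for $b=a$, with nonzero diagonal in the limit, so
they converge as well (`tendsto_of_triangular`).

The equations hold only at charges in $\epsilon\mathbb Z^{\mathcal S}$, while the limit is wanted at
every $s$. All limits are therefore taken jointly in $\epsilon$, $s$ and one time, and then
evaluated along lattice points converging to $s$. -/

open PowerSeries in
lemma constantCoeff_expSeries (f : PowerSeries ℂ) :
    constantCoeff (expSeries f) = Complex.exp (constantCoeff f) := by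
  have h : constantCoeff (f - C (constantCoeff f)) = 0 := by simp
  -- The vanishing criterion for constant coefficients of a substitution needs an outer series
  -- without constant term, hence the subtraction of 1.
  have h1 : constantCoeff ((exp ℂ - 1).subst (f - C (constantCoeff f))) = 0 :=
    PowerSeries.constantCoeff_subst_eq_zero h _ (by simp)
  have hs : HasSubst (f - C (constantCoeff f)) := HasSubst.of_constantCoeff_zero' h
  have h2 : (1 : PowerSeries ℂ).subst (f - C (constantCoeff f)) = 1 := by
    rw [← coe_substAlgHom hs, map_one]
  rw [subst_sub hs, h2, map_sub, sub_eq_zero] at h1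
  simp only [expSeries, map_mul, constantCoeff_C]
  erw [h1]
  simp

-- Together with the constant coefficient, this differential equation determines the exponential;
-- the definition by substitution is not unfolded after this point.
open PowerSeries in
lemma derivative_expSeries (f : PowerSeries ℂ) :
    derivative ℂ (expSeries f) = derivative ℂ f * expSeries f := by
  have h : constantCoeff (f - C (constantCoeff f)) = 0 := by simp
  have hs : HasSubst (f - C (constantCoeff f)) := HasSubst.of_constantCoeff_zero' h
  simp only [expSeries, Derivation.leibniz, derivative_subst hs, derivative_exp, map_sub,
    derivative_C, smul_eq_mul]
  ring

open PowerSeries in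
lemma coeff_zero_expSeries (f : PowerSeries ℂ) : coeff 0 (expSeries f) = Complex.exp (coeff 0 f) := by
  simpa using constantCoeff_expSeries f

-- Coefficient `n` of the differential equation. It expresses each coefficient through finitely many
-- coefficients of `f` and earlier ones of the exponential, so convergence and differentiability
-- pass from `f` to `expSeries f` by strong induction.
open PowerSeries in
lemma coeff_succ_expSeries (f : PowerSeries ℂ) (n : ℕ) :
    coeff (n + 1) (expSeries f) =
      (∑ k ∈ Finset.range (n + 1), coeff (k + 1) f * (k + 1) * coeff (n - k) (expSeries f)) /
        (n + 1) := by
  have h := congrArg (coeff n) (derivative_expSeries f)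
  rw [coeff_derivative, coeff_mul, Finset.Nat.sum_antidiagonal_eq_sum_range_succ_mk] at h
  rw [eq_div_iff (by exact_mod_cast n.succ_ne_zero), h]
  simp [coeff_derivative]

open PowerSeries in
/-- A power series is determined by its constant coefficient and its logarithmic derivative. -/
lemma eq_expSeries_of_derivative {f g : PowerSeries ℂ}
    (h0 : constantCoeff g = Complex.exp (constantCoeff f))
    (h1 : derivative ℂ g = derivative ℂ f * g) : g = expSeries f := by
  ext n
  induction n using Nat.strong_induction_on with
  | _ n ih =>
    cases n with
    | zero => rw [coeff_zero_expSeries]; simpa using h0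
    | succ n =>
      have h := congrArg (coeff n) h1
      rw [coeff_derivative, coeff_mul, Finset.Nat.sum_antidiagonal_eq_sum_range_succ_mk] at h
      rw [coeff_succ_expSeries, eq_div_iff (by exact_mod_cast n.succ_ne_zero), h]
      refine Finset.sum_congr rfl fun k _ => ?_
      simp only [coeff_derivative]
      rw [ih _ (by omega)]

lemma expSeries_add (f g : PowerSeries ℂ) : expSeries (f + g) = expSeries f * expSeries g := by
  symm
  apply eq_expSeries_of_derivative
  · simp [constantCoeff_expSeries, Complex.exp_add]
  · rw [Derivation.leibniz, derivative_expSeries, derivative_expSeries, map_add, smul_eq_mul,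
      smul_eq_mul]
    ring

lemma expSeries_zero : expSeries 0 = 1 := by
  symm
  apply eq_expSeries_of_derivative <;> simp

lemma expSeries_nsmul (n : ℕ) (f : PowerSeries ℂ) : expSeries (n • f) = expSeries f ^ n := by
  induction n with
  | zero => simp [expSeries_zero]
  | succ n ih => rw [succ_nsmul, expSeries_add, ih, pow_succ]

lemma isUnit_expSeries (f : PowerSeries ℂ) : IsUnit (expSeries f) := by
  refine IsUnit.of_mul_eq_one (expSeries (-f)) ?_
  rw [← expSeries_add, add_neg_cancel, expSeries_zero]

open PowerSeries in
lemma tendsto_coeff_expSeries {α : Type*} {l : Filter α} {F : α → PowerSeries ℂ}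
    {f : PowerSeries ℂ} (h : ∀ n, Tendsto (fun y => coeff n (F y)) l (𝓝 (coeff n f))) (n : ℕ) :
    Tendsto (fun y => coeff n (expSeries (F y))) l (𝓝 (coeff n (expSeries f))) := by
  induction n using Nat.strong_induction_on with
  | _ n ih =>
    cases n with
    | zero =>
      simp only [coeff_zero_expSeries]
      exact (Complex.continuous_exp.tendsto _).comp (h 0)
    | succ n =>
      simp only [coeff_succ_expSeries]
      refine Tendsto.div_const (tendsto_finsetSum _ fun k _ => ?_) _
      exact ((h _).mul_const _).mul (ih _ (by omega))

open PowerSeries in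
lemma hasDerivAt_coeff_expSeries {F : ℂ → PowerSeries ℂ} {f' : PowerSeries ℂ} {τ : ℂ}
    (h : ∀ n, HasDerivAt (fun y => coeff n (F y)) (coeff n f') τ) (n : ℕ) :
    HasDerivAt (fun y => coeff n (expSeries (F y))) (coeff n (f' * expSeries (F τ))) τ := by
  induction n using Nat.strong_induction_on with
  | _ n ih =>
    cases n with
    | zero =>
      simp only [coeff_zero_expSeries]
      have key : coeff 0 (f' * expSeries (F τ)) = Complex.exp (coeff 0 (F τ)) * coeff 0 f' := by
        simp [constantCoeff_expSeries, mul_comm]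
      rw [key]
      exact (h 0).cexp
    | succ n =>
      simp only [coeff_succ_expSeries]
      -- The product rule in the formal variable `X` for `f' * expSeries (F τ)` has the same two
      -- sums as the product rule in `τ` applied to the recursion; hence the recursion propagates
      -- the claimed derivative.
      have key : coeff (n + 1) (f' * expSeries (F τ)) * ((n : ℂ) + 1) =
          ∑ k ∈ Finset.range (n + 1), (coeff (k + 1) f' * (k + 1) * coeff (n - k) (expSeries (F τ)) +
            coeff (k + 1) (F τ) * (k + 1) * coeff (n - k) (f' * expSeries (F τ))) := by
        rw [← coeff_derivative, Derivation.leibniz, derivative_expSeries, smul_eq_mul, smul_eq_mul,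
          show f' * (derivative ℂ (F τ) * expSeries (F τ)) + expSeries (F τ) * derivative ℂ f' =
            derivative ℂ f' * expSeries (F τ) + derivative ℂ (F τ) * (f' * expSeries (F τ)) by ring,
          map_add, coeff_mul, coeff_mul _ (derivative ℂ (F τ)),
          Finset.Nat.sum_antidiagonal_eq_sum_range_succ_mk,
          Finset.Nat.sum_antidiagonal_eq_sum_range_succ_mk, ← Finset.sum_add_distrib]
        simp [coeff_derivative]
      rw [← eq_div_iff (by exact_mod_cast n.succ_ne_zero)] at key
      rw [key]
      refine HasDerivAt.div_const (HasDerivAt.fun_sum fun k _ => ?_) _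
      exact ((h _).mul_const _).mul (ih _ (by omega))

/-! ### Twisted convolution

`DiffOp.mul` and `ShiftOp.comp` are both instances of the product of formal series `∑ P_i T^i` with
coefficients in functions on a set with an action of `ℤ`. -/

section Convolution

variable {X R : Type*} [Ring R]

/-- The product determined by `(P T^i)(Q T^j) = P · (Q ∘ σ i) T^{i+j}`. -/
def twMul (σ : ℤ → X → X) (P Q : ℤ → X → R) : ℤ → X → R :=
  fun m x => ∑ᶠ i : ℤ, P i x * Q (m - i) (σ i x)

/-- Finite sums compute the product. -/
lemma twMul_eq_sum {σ : ℤ → X → X} {P Q : ℤ → X → R} {m : ℤ} {x : X} (I : Finset ℤ)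
    (h : ∀ i ∉ I, P i x * Q (m - i) (σ i x) = 0) :
    twMul σ P Q m x = ∑ i ∈ I, P i x * Q (m - i) (σ i x) := by
  refine finsum_eq_sum_of_support_subset _ fun i hi => ?_
  by_contra hI
  exact hi (h i hI)

/-- `P` contains no powers `T^m` with `m > p`. -/
def BddAbv (p : ℤ) (P : ℤ → X → R) : Prop := ∀ m x, p < m → P m x = 0

/-- `P` contains no powers `T^m` with `m < p`. -/
def BddBlw (p : ℤ) (P : ℤ → X → R) : Prop := ∀ m x, m < p → P m x = 0

variable {σ : ℤ → X → X} {P Q U : ℤ → X → R} {p q r : ℤ}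

lemma BddAbv.mul_eq_sum (hP : BddAbv p P) (hQ : BddAbv q Q) (m : ℤ) (x : X) :
    twMul σ P Q m x = ∑ i ∈ Finset.Icc (m - q) p, P i x * Q (m - i) (σ i x) := by
  refine twMul_eq_sum _ fun i hi => ?_
  rw [Finset.mem_Icc, not_and_or, not_le, not_le] at hi
  rcases hi with hi | hi
  · rw [hQ _ _ (by omega), mul_zero]
  · rw [hP _ _ hi, zero_mul]

lemma BddBlw.mul_eq_sum (hP : BddBlw p P) (hQ : BddBlw q Q) (m : ℤ) (x : X) :
    twMul σ P Q m x = ∑ i ∈ Finset.Icc p (m - q), P i x * Q (m - i) (σ i x) := by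
  refine twMul_eq_sum _ fun i hi => ?_
  rw [Finset.mem_Icc, not_and_or, not_le, not_le] at hi
  rcases hi with hi | hi
  · rw [hP _ _ hi, zero_mul]
  · rw [hQ _ _ (by omega), mul_zero]

lemma BddAbv.twMul (hP : BddAbv p P) (hQ : BddAbv q Q) : BddAbv (p + q) (twMul σ P Q) := by
  intro m x hm
  rw [hP.mul_eq_sum hQ, Finset.Icc_eq_empty (by omega), Finset.sum_empty]

lemma BddBlw.twMul (hP : BddBlw p P) (hQ : BddBlw q Q) : BddBlw (p + q) (twMul σ P Q) := by
  intro m x hm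
  rw [hP.mul_eq_sum hQ, Finset.Icc_eq_empty (by omega), Finset.sum_empty]

/-- Once `i` (the degree taken from `P`) and `k` (the total degree taken from `P` and `Q`) are
confined to finite sets, both bracketings are the same finite double sum. The four vanishing
hypotheses are what this confinement requires, so operators bounded above and operators bounded
below are treated alike. -/
lemma twMul_assoc_of_finset (hσ : ∀ i j x, σ j (σ i x) = σ (i + j) x) {m : ℤ} {x : X}
    (I J : Finset ℤ)
    (hJ : ∀ k ∉ J, twMul σ P Q k x * U (m - k) (σ k x) = 0)
    (hI : ∀ k ∈ J, ∀ i ∉ I, P i x * Q (k - i) (σ i x) = 0)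
    (hI' : ∀ i ∉ I, P i x * twMul σ Q U (m - i) (σ i x) = 0)
    (hJ' : ∀ i ∈ I, ∀ k ∉ J, Q (k - i) (σ i x) * U (m - k) (σ k x) = 0) :
    twMul σ (twMul σ P Q) U m x = twMul σ P (twMul σ Q U) m x := by
  rw [twMul_eq_sum J hJ, twMul_eq_sum I hI',
    Finset.sum_congr rfl fun k hk => by rw [twMul_eq_sum I (hI k hk), Finset.sum_mul],
    Finset.sum_comm]
  refine Finset.sum_congr rfl fun i hi => ?_
  have h : twMul σ Q U (m - i) (σ i x) = ∑ k ∈ J, Q (k - i) (σ i x) * U (m - k) (σ k x) := by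
    -- Reindexing by `k ↦ k - i` replaces the degree in `Q` by the total degree in `P` and `Q`.
    have h' : twMul σ Q U (m - i) (σ i x) =
        ∑ᶠ k : ℤ, Q (k - i) (σ i x) * U (m - k) (σ k x) := by
      rw [← finsum_comp_equiv (Equiv.subRight i).symm]
      refine finsum_congr fun k => ?_
      simp only [Equiv.subRight_symm_apply, add_sub_cancel_right, hσ]
      rw [add_comm i k, sub_sub, add_comm i k]
    rw [h']
    refine finsum_eq_sum_of_support_subset _ fun k hk => ?_
    by_contra hkJ
    exact hk (hJ' i hi k hkJ)
  rw [h, Finset.mul_sum]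
  exact Finset.sum_congr rfl fun k _ => mul_assoc _ _ _

/-- A contributing term has `i ≤ p`, `k - i ≤ q` and `m - k ≤ r`; these inequalities bound `i` and
`k` on both sides. -/
lemma BddAbv.assoc (hσ : ∀ i j x, σ j (σ i x) = σ (i + j) x) (hP : BddAbv p P) (hQ : BddAbv q Q)
    (hU : BddAbv r U) : TodaWhitham.twMul σ (TodaWhitham.twMul σ P Q) U =
      TodaWhitham.twMul σ P (TodaWhitham.twMul σ Q U) := by
  funext m x
  have hPQ : BddAbv (p + q) (TodaWhitham.twMul σ P Q) := hP.twMul hQ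
  have hQU : BddAbv (q + r) (TodaWhitham.twMul σ Q U) := hQ.twMul hU
  refine twMul_assoc_of_finset hσ (Finset.Icc (m - r - q) p) (Finset.Icc (m - r) (p + q))
    ?_ ?_ ?_ ?_
  · intro k hk
    rw [Finset.mem_Icc, not_and_or, not_le, not_le] at hk
    rcases hk with hk | hk
    · rw [hU _ _ (by omega), mul_zero]
    · rw [hPQ _ _ hk, zero_mul]
  · intro k hk i hi
    rw [Finset.mem_Icc] at hk
    rw [Finset.mem_Icc, not_and_or, not_le, not_le] at hi
    rcases hi with hi | hi
    · rw [hQ _ _ (by omega), mul_zero]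
    · rw [hP _ _ hi, zero_mul]
  · intro i hi
    rw [Finset.mem_Icc, not_and_or, not_le, not_le] at hi
    rcases hi with hi | hi
    · rw [hQU _ _ (by omega), mul_zero]
    · rw [hP _ _ hi, zero_mul]
  · intro i hi k hk
    rw [Finset.mem_Icc] at hi
    rw [Finset.mem_Icc, not_and_or, not_le, not_le] at hk
    rcases hk with hk | hk
    · rw [hU _ _ (by omega), mul_zero]
    · rw [hQ _ _ (by omega), zero_mul]

lemma BddBlw.assoc (hσ : ∀ i j x, σ j (σ i x) = σ (i + j) x) (hP : BddBlw p P) (hQ : BddBlw q Q)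
    (hU : BddBlw r U) : TodaWhitham.twMul σ (TodaWhitham.twMul σ P Q) U =
      TodaWhitham.twMul σ P (TodaWhitham.twMul σ Q U) := by
  funext m x
  have hPQ : BddBlw (p + q) (TodaWhitham.twMul σ P Q) := hP.twMul hQ
  have hQU : BddBlw (q + r) (TodaWhitham.twMul σ Q U) := hQ.twMul hU
  refine twMul_assoc_of_finset hσ (Finset.Icc p (m - r - q)) (Finset.Icc (p + q) (m - r))
    ?_ ?_ ?_ ?_
  · intro k hk
    rw [Finset.mem_Icc, not_and_or, not_le, not_le] at hk
    rcases hk with hk | hk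
    · rw [hPQ _ _ hk, zero_mul]
    · rw [hU _ _ (by omega), mul_zero]
  · intro k hk i hi
    rw [Finset.mem_Icc] at hk
    rw [Finset.mem_Icc, not_and_or, not_le, not_le] at hi
    rcases hi with hi | hi
    · rw [hP _ _ hi, zero_mul]
    · rw [hQ _ _ (by omega), mul_zero]
  · intro i hi
    rw [Finset.mem_Icc, not_and_or, not_le, not_le] at hi
    rcases hi with hi | hi
    · rw [hP _ _ hi, zero_mul]
    · rw [hQU _ _ (by omega), mul_zero]
  · intro i hi k hk
    rw [Finset.mem_Icc] at hi
    rw [Finset.mem_Icc, not_and_or, not_le, not_le] at hk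
    rcases hk with hk | hk
    · rw [hQ _ _ (by omega), zero_mul]
    · rw [hU _ _ (by omega), mul_zero]

/-- The series `T^k`. -/
def twSingle (k : ℤ) : ℤ → X → R := fun m _ => if m = k then 1 else 0

lemma bddAbv_twSingle (k : ℤ) : BddAbv k (twSingle k : ℤ → X → R) := by
  intro m x hm
  simp [twSingle, hm.ne']

lemma twMul_twSingle (k m : ℤ) (x : X) : twMul σ P (twSingle k) m x = P (m - k) x := by
  rw [twMul_eq_sum {m - k}]
  · simp [twSingle]
  · intro i hi
    rw [Finset.mem_singleton] at hi
    rw [twSingle, if_neg (by omega), mul_zero]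

lemma twSingle_zero_mul (hσ : ∀ x, σ 0 x = x) : twMul σ (twSingle 0) P = P := by
  funext m x
  rw [twMul_eq_sum {0}]
  · simp [twSingle, hσ]
  · intro i hi
    rw [Finset.mem_singleton] at hi
    rw [twSingle, if_neg hi, zero_mul]

lemma twMul_twSingle_zero : twMul σ P (twSingle 0) = P := by
  funext m x
  rw [twMul_twSingle, sub_zero]

end Convolution

lemma DiffOp.mul_eq_twMul {N : ℕ} (X Y : DiffOp N) : X.mul Y = twMul (fun i n => n + i) X Y := rfl

lemma ShiftOp.comp_eq_twMul {N : ℕ} (ε : ℝ) (v : ZeroCharge N) (P Q : ShiftOp N) :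
    ShiftOp.comp ε v P Q = twMul (fun i x => x.shift v (ε * i)) P Q := rfl

/-! ### Scalar Lax operators -/

section Lax

variable {N : ℕ} {ε : ℝ} {v : ZeroCharge N}

lemma Slow.shift_shift (x : Slow N) (v : ZeroCharge N) (r r' : ℝ) :
    (x.shift v r).shift v r' = x.shift v (r + r') := by
  simp only [Slow.shift, add_smul, add_assoc]

lemma Slow.shift_zero (x : Slow N) (v : ZeroCharge N) : x.shift v 0 = x := by
  simp only [Slow.shift, zero_smul, add_zero]

lemma shift_action (ε : ℝ) (v : ZeroCharge N) (i j : ℤ) (x : Slow N) :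
    (x.shift v (ε * i)).shift v (ε * j) = x.shift v (ε * ((i + j : ℤ) : ℝ)) := by
  rw [Slow.shift_shift]
  push_cast
  rw [mul_add]

lemma bddAbv_ofSeq (A : ℕ → Slow N → ℂ) : BddAbv 0 (ShiftOp.ofSeq A) := by
  intro m x hm
  simp [ShiftOp.ofSeq, not_le.mpr hm]

lemma bddAbv_single (k : ℤ) : BddAbv k (ShiftOp.single N k) := bddAbv_twSingle k

lemma comp_single (P : ShiftOp N) (k m : ℤ) (x : Slow N) :
    ShiftOp.comp ε v P (ShiftOp.single N k) m x = P (m - k) x :=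
  twMul_twSingle (σ := fun (i : ℤ) (x : Slow N) => x.shift v (ε * i)) k m x

lemma single_zero_comp (P : ShiftOp N) : ShiftOp.comp ε v (ShiftOp.single N 0) P = P :=
  twSingle_zero_mul (σ := fun (i : ℤ) (x : Slow N) => x.shift v (ε * i))
    fun x => by simp [Slow.shift_zero]

lemma bddAbv_comp {P Q : ShiftOp N} {p q : ℤ} (hP : BddAbv p P) (hQ : BddAbv q Q) :
    BddAbv (p + q) (ShiftOp.comp ε v P Q) := hP.twMul hQ

lemma comp_assoc {P Q U : ShiftOp N} {p q r : ℤ} (hP : BddAbv p P) (hQ : BddAbv q Q)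
    (hU : BddAbv r U) : ShiftOp.comp ε v (ShiftOp.comp ε v P Q) U =
      ShiftOp.comp ε v P (ShiftOp.comp ε v Q U) :=
  hP.assoc (fun i j x => shift_action ε v i j x) hQ hU

lemma comp_eq_sum {P Q : ShiftOp N} {p q : ℤ} (hP : BddAbv p P) (hQ : BddAbv q Q) (m : ℤ)
    (x : Slow N) : ShiftOp.comp ε v P Q m x =
      ∑ i ∈ Finset.Icc (m - q) p, P i x * Q (m - i) (x.shift v (ε * i)) :=
  hP.mul_eq_sum (σ := fun (i : ℤ) (x : Slow N) => x.shift v (ε * i)) hQ m x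

/-- The recursion for the inverse divides only by the leading coefficient at `x` itself. Values of
`invSeq` at shifted points enter as they are, even if a leading coefficient vanishes there, so a
single nonvanishing condition suffices. -/
lemma ofSeq_comp_inv (A : ℕ → Slow N → ℂ) (m : ℤ) {x : Slow N} (hx : A 0 x ≠ 0) :
    ShiftOp.comp ε v (ShiftOp.ofSeq A) (ShiftOp.ofSeq (invSeq ε v A)) m x =
      ShiftOp.single N 0 m x := by
  rcases lt_or_ge 0 m with hm | hm
  · rw [bddAbv_comp (bddAbv_ofSeq A) (bddAbv_ofSeq _) m x (by simpa using hm),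
      bddAbv_single 0 m x hm]
  rw [comp_eq_sum (bddAbv_ofSeq A) (bddAbv_ofSeq _)]
  obtain ⟨n, rfl⟩ : ∃ n : ℕ, m = -n := ⟨(-m).toNat, by omega⟩
  cases n with
  | zero =>
    simp [ShiftOp.ofSeq, ShiftOp.single, invSeq, Slow.shift_zero, hx]
  | succ k =>
    have h1 : Finset.Icc (-((k + 1 : ℕ) : ℤ) - 0) 0 =
        insert 0 (Finset.Icc (-((k + 1 : ℕ) : ℤ)) (-1)) := by
      ext i; simp only [Finset.mem_Icc, Finset.mem_insert]; omega
    rw [h1, Finset.sum_insert (by simp)]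
    have h2 : ∑ i ∈ Finset.Icc (-((k + 1 : ℕ) : ℤ)) (-1), ShiftOp.ofSeq A i x *
        ShiftOp.ofSeq (invSeq ε v A) (-((k + 1 : ℕ) : ℤ) - i) (x.shift v (ε * i)) =
        ∑ i ∈ Finset.range (k + 1), A (k + 1 - i) x *
          invSeq ε v A i (x.shift v (-(ε * (k + 1 - i : ℕ)))) := by
      -- A degree `i` in `𝒦`, between `-(k + 1)` and `-1`, leaves degree `-(k + 1 + i)` for the
      -- inverse.
      refine Finset.sum_nbij' (fun i => (k + 1 + i : ℤ).toNat) (fun i => (i : ℤ) - (k + 1))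
        ?_ ?_ ?_ ?_ ?_
      · intro i hi; simp only [Finset.mem_Icc, Finset.mem_range] at *; omega
      · intro i hi; simp only [Finset.mem_Icc, Finset.mem_range] at *; omega
      · intro i hi; simp only [Finset.mem_Icc] at *; omega
      · intro i hi; simp only [Finset.mem_range] at *; omega
      · intro i hi
        simp only [Finset.mem_Icc] at hi
        obtain ⟨l, rfl⟩ : ∃ l : ℕ, i = -((l : ℤ) + 1) := ⟨(-i - 1).toNat, by omega⟩
        have e1 : (k + 1 + -((l : ℤ) + 1) : ℤ).toNat = k - l := by omega
        have e2 : k + 1 - (k - l) = l + 1 := by omega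
        have e3 : (- -((l : ℤ) + 1)).toNat = l + 1 := by omega
        have e4 : (-(-((k + 1 : ℕ) : ℤ) - -((l : ℤ) + 1))).toNat = k - l := by omega
        rw [ShiftOp.ofSeq, if_pos (by omega), ShiftOp.ofSeq, if_pos (by omega), e1, e2, e3, e4]
        congr 3
        push_cast
        ring
    rw [h2, Finset.sum_range]
    have h3 : invSeq ε v A (k + 1) x = -(A 0 x)⁻¹ * ∑ i : Fin (k + 1), A (k + 1 - i) x *
        invSeq ε v A i (x.shift v (-(ε * (k + 1 - i : ℕ)))) := by
      rw [invSeq]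
    have h4 : ShiftOp.ofSeq (invSeq ε v A) (-((k + 1 : ℕ) : ℤ) - 0) (x.shift v (ε * (0 : ℤ))) =
        invSeq ε v A (k + 1) x := by
      rw [ShiftOp.ofSeq, if_pos (by omega), Int.cast_zero, mul_zero, Slow.shift_zero]
      congr 1
    rw [h4, h3, ShiftOp.single, if_neg (by omega)]
    simp only [ShiftOp.ofSeq, le_refl, if_true, neg_zero, Int.toNat_zero]
    rw [← mul_assoc, mul_neg, mul_inv_cancel₀ hx, neg_one_mul, neg_add_cancel]

/-- The inverse of `∑ A_i T^{-i}` is also a left inverse, at points where the leading coefficients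
that enter do not vanish. -/
lemma inv_comp_ofSeq (A : ℕ → Slow N → ℂ) (n : ℕ) : ∀ x : Slow N,
    (∀ k : ℕ, k ≤ n → A 0 (x.shift v (ε * (-k : ℤ))) ≠ 0) →
    ShiftOp.comp ε v (ShiftOp.ofSeq (invSeq ε v A)) (ShiftOp.ofSeq A) (-n) x =
      ShiftOp.single N 0 (-n) x := by
  induction n using Nat.strong_induction_on with
  | _ n ih =>
    intro x hx
    have hx0 : A 0 x ≠ 0 := by simpa [Slow.shift_zero] using hx 0 (Nat.zero_le n)
    set K := ShiftOp.ofSeq A with hK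
    set K' := ShiftOp.ofSeq (invSeq ε v A) with hK'
    have bK : BddAbv 0 K := bddAbv_ofSeq A
    have bK' : BddAbv 0 K' := bddAbv_ofSeq _
    have bC : BddAbv 0 (ShiftOp.comp ε v K' K) := by simpa using bddAbv_comp bK' bK
    have bC' : BddAbv 0 (ShiftOp.comp ε v K K') := by simpa using bddAbv_comp bK bK'
    -- With the right inverse, `K (K' K) = (K K') K = K = K · 1`. Comparing the outer expressions in
    -- degree `-n`, the terms with a negative degree of `K` agree by induction at shifted points,
    -- and cancelling `A 0 x` in the remaining term gives the claim.
    have e : ShiftOp.comp ε v K (ShiftOp.comp ε v K' K) (-n) x = K (-n) x := by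
      rw [← comp_assoc bK bK' bK, comp_eq_sum bC' bK,
        Finset.sum_congr rfl fun i _ => by rw [ofSeq_comp_inv A i hx0],
        ← comp_eq_sum (bddAbv_single 0) bK, single_zero_comp]
    have e' : ShiftOp.comp ε v K (ShiftOp.single N 0) (-n) x = K (-n) x := by
      rw [comp_single, sub_zero]
    rw [← e', comp_eq_sum bK bC, comp_eq_sum bK (bddAbv_single 0)] at e
    have h0 : (0 : ℤ) ∈ Finset.Icc (-(n : ℤ) - 0) 0 := by simp
    rw [← Finset.add_sum_erase _ _ h0, ← Finset.add_sum_erase _ _ h0] at e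
    have rest : ∀ i ∈ (Finset.Icc (-(n : ℤ) - 0) 0).erase 0,
        K i x * ShiftOp.comp ε v K' K (-n - i) (x.shift v (ε * i)) =
          K i x * ShiftOp.single N 0 (-n - i) (x.shift v (ε * i)) := by
      intro i hi
      rw [Finset.mem_erase, Finset.mem_Icc] at hi
      obtain ⟨l, rfl⟩ : ∃ l : ℕ, i = -(l : ℤ) := ⟨(-i).toNat, by omega⟩
      rw [show -(n : ℤ) - -(l : ℤ) = -((n - l : ℕ) : ℤ) by omega, ih (n - l) (by omega)]
      intro k hk
      rw [shift_action, show (-(l : ℤ) + -(k : ℤ)) = -((l + k : ℕ) : ℤ) by push_cast; ring]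
      exact hx _ (by omega)
    rw [Finset.sum_congr rfl rest, add_left_inj] at e
    have hK0 : K 0 x ≠ 0 := by simpa [hK, ShiftOp.ofSeq] using hx0
    have e2 := mul_left_cancel₀ hK0 e
    simpa [Slow.shift_zero] using e2

lemma bddAbv_lax (A : ℕ → Slow N → ℂ) : BddAbv 1 (lax ε v A) := by
  simpa [lax] using bddAbv_comp (ε := ε) (v := v)
    (bddAbv_comp (ε := ε) (v := v) (bddAbv_ofSeq A) (bddAbv_single 1)) (bddAbv_ofSeq (invSeq ε v A))

lemma bddAbv_pow {P : ShiftOp N} (hP : BddAbv 1 P) (j : ℕ) : BddAbv j (ShiftOp.pow ε v P j) := by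
  induction j with
  | zero => exact bddAbv_single 0
  | succ j ih => simpa [ShiftOp.pow] using bddAbv_comp (ε := ε) (v := v) ih hP

/-- This is `𝒦 T (𝒦⁻¹ 𝒦) = 𝒦 T`. The factor `𝒦 T` moves the point by at most one step forward, and
the left inverse is then used in degrees that move it back no further than `m` steps; this is the
range of `k` in the hypothesis. -/
lemma lax_comp_ofSeq (A : ℕ → Slow N → ℂ) (m : ℤ) (x : Slow N)
    (hx : ∀ k : ℤ, m ≤ k → k ≤ 1 → A 0 (x.shift v (ε * k)) ≠ 0) :
    ShiftOp.comp ε v (lax ε v A) (ShiftOp.ofSeq A) m x = ShiftOp.ofSeq A (m - 1) x := by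
  have bK := bddAbv_ofSeq A
  have bK' := bddAbv_ofSeq (invSeq ε v A)
  have bT : BddAbv 1 (ShiftOp.comp ε v (ShiftOp.ofSeq A) (ShiftOp.single N 1)) := by
    simpa using bddAbv_comp (ε := ε) (v := v) bK (bddAbv_single 1)
  have bC : BddAbv 0 (ShiftOp.comp ε v (ShiftOp.ofSeq (invSeq ε v A)) (ShiftOp.ofSeq A)) := by
    simpa using bddAbv_comp (ε := ε) (v := v) bK' bK
  rw [← comp_single (ε := ε) (v := v) (ShiftOp.ofSeq A), lax, comp_assoc bT bK' bK, comp_eq_sum bT bC]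
  rw [Finset.sum_congr rfl (g := fun i =>
    ShiftOp.comp ε v (ShiftOp.ofSeq A) (ShiftOp.single N 1) i x *
      ShiftOp.single N 0 (m - i) (x.shift v (ε * i)))]
  · rw [← comp_eq_sum bT (bddAbv_single 0), comp_single, sub_zero]
  intro i hi
  rw [Finset.mem_Icc] at hi
  obtain ⟨n, hn⟩ : ∃ n : ℕ, m - i = -(n : ℤ) := ⟨(i - m).toNat, by omega⟩
  rw [hn, inv_comp_ofSeq]
  intro k hk
  rw [shift_action]
  exact hx _ (by omega) (by omega)

/-- `ℒ^j 𝒦 = 𝒦 T^j`, at points where the leading coefficients that enter do not vanish. -/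
lemma lax_pow_comp_ofSeq (A : ℕ → Slow N → ℂ) (j : ℕ) : ∀ (m : ℤ) (x : Slow N),
    (∀ k : ℤ, m - j ≤ k → k ≤ j → A 0 (x.shift v (ε * k)) ≠ 0) →
    ShiftOp.comp ε v (ShiftOp.pow ε v (lax ε v A) j) (ShiftOp.ofSeq A) m x =
      ShiftOp.ofSeq A (m - j) x := by
  induction j with
  | zero =>
    intro m x _
    rw [ShiftOp.pow, Nat.cast_zero, sub_zero, single_zero_comp]
  | succ j ih =>
    intro m x hx
    have bK := bddAbv_ofSeq A
    have bL : BddAbv 1 (lax ε v A) := bddAbv_lax A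
    have bP : BddAbv j (ShiftOp.pow ε v (lax ε v A) j) := bddAbv_pow bL j
    have bT : BddAbv 1 (ShiftOp.comp ε v (ShiftOp.ofSeq A) (ShiftOp.single N 1)) := by
      simpa using bddAbv_comp (ε := ε) (v := v) bK (bddAbv_single 1)
    have bC : BddAbv 1 (ShiftOp.comp ε v (lax ε v A) (ShiftOp.ofSeq A)) := by
      simpa using bddAbv_comp (ε := ε) (v := v) bL bK
    rw [ShiftOp.pow, comp_assoc bP bL bK, comp_eq_sum bP bC]
    rw [Finset.sum_congr rfl (g := fun i => ShiftOp.pow ε v (lax ε v A) j i x *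
      ShiftOp.comp ε v (ShiftOp.ofSeq A) (ShiftOp.single N 1) (m - i) (x.shift v (ε * i)))]
    · rw [← comp_eq_sum bP bT, ← comp_assoc bP bK (bddAbv_single 1), comp_single, ih]
      · congr 1; push_cast; ring
      · intro k h1 h2
        exact hx k (by push_cast; omega) (by push_cast; omega)
    intro i hi
    rw [Finset.mem_Icc] at hi
    rw [comp_single, lax_comp_ofSeq]
    intro k h1 h2
    rw [shift_action]
    exact hx _ (by push_cast; omega) (by push_cast; omega)

/-- The coefficients of `ℒ^j` in nonnegative powers of `T` are determined by the amplitudes. -/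
lemma lax_pow_sum (A : ℕ → Slow N → ℂ) (j : ℕ) (m : ℤ) (hm : 0 ≤ m) (x : Slow N)
    (hx : ∀ k : ℤ, -j ≤ k → k ≤ j → A 0 (x.shift v (ε * k)) ≠ 0) :
    ∑ i ∈ Finset.range (j + 1), ShiftOp.pow ε v (lax ε v A) j i x *
      ShiftOp.ofSeq A (m - i) (x.shift v (ε * i)) = ShiftOp.ofSeq A (m - j) x := by
  have bK := bddAbv_ofSeq A
  have bP : BddAbv j (ShiftOp.pow ε v (lax ε v A) j) := bddAbv_pow (bddAbv_lax A) j
  rw [← lax_pow_comp_ofSeq (ε := ε) (v := v) A j m x fun k h1 h2 => hx k (by omega) h2]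
  -- Terms with `i > j` vanish because `ℒ^j` has order at most `j`. Those with `i < 0` vanish
  -- because `m ≥ 0` and `𝒦` has no positive powers; the negative part of `ℒ^j` is thus invisible
  -- here.
  rw [ShiftOp.comp_eq_twMul, twMul_eq_sum ((Finset.range (j + 1)).map Nat.castEmbedding)]
  · rw [Finset.sum_map]
    rfl
  · intro i hi
    by_cases hi0 : 0 ≤ i
    · obtain ⟨l, rfl⟩ := Int.eq_ofNat_of_zero_le hi0
      rw [bP, zero_mul]
      simp only [Finset.mem_map, Finset.mem_range, Nat.castEmbedding_apply, Nat.cast_inj,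
        exists_eq_right] at hi
      omega
    · rw [bK _ _ (by omega), mul_zero]

end Lax

/-! ### Wave equations of the Toda hierarchy -/

section DiffOps

variable {N : ℕ}

lemma add_action (i j n : ℤ) : n + i + j = n + (i + j) := add_assoc n i j

lemma BddAbv.diffOp_assoc {X Y Z : DiffOp N} {p q r : ℤ} (hX : BddAbv p X) (hY : BddAbv q Y)
    (hZ : BddAbv r Z) : (X.mul Y).mul Z = X.mul (Y.mul Z) :=
  hX.assoc (σ := fun (i n : ℤ) => n + i) add_action hY hZ

lemma BddBlw.diffOp_assoc {X Y Z : DiffOp N} {p q r : ℤ} (hX : BddBlw p X) (hY : BddBlw q Y)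
    (hZ : BddBlw r Z) : (X.mul Y).mul Z = X.mul (Y.mul Z) :=
  hX.assoc (σ := fun (i n : ℤ) => n + i) add_action hY hZ

lemma BddAbv.diffOp_mul {X Y : DiffOp N} {p q : ℤ} (hX : BddAbv p X) (hY : BddAbv q Y) :
    BddAbv (p + q) (X.mul Y) := hX.twMul hY

lemma BddBlw.diffOp_mul {X Y : DiffOp N} {p q : ℤ} (hX : BddBlw p X) (hY : BddBlw q Y) :
    BddBlw (p + q) (X.mul Y) := hX.twMul hY

lemma BddAbv.diffOp_mul_eq_sum {X Y : DiffOp N} {p q : ℤ} (hX : BddAbv p X) (hY : BddAbv q Y)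
    (m n : ℤ) : X.mul Y m n = ∑ i ∈ Finset.Icc (m - q) p, X i n * Y (m - i) (n + i) :=
  hX.mul_eq_sum (σ := fun (i n : ℤ) => n + i) hY m n

lemma BddBlw.diffOp_mul_eq_sum {X Y : DiffOp N} {p q : ℤ} (hX : BddBlw p X) (hY : BddBlw q Y)
    (m n : ℤ) : X.mul Y m n = ∑ i ∈ Finset.Icc p (m - q), X i n * Y (m - i) (n + i) :=
  hX.mul_eq_sum (σ := fun (i n : ℤ) => n + i) hY m n

lemma DiffOp.mul_one_op (X : DiffOp N) : X.mul (DiffOp.one N) = X :=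
  twMul_twSingle_zero (σ := fun (i n : ℤ) => n + i)

lemma DiffOp.one_op_mul (X : DiffOp N) : (DiffOp.one N).mul X = X :=
  twSingle_zero_mul (σ := fun (i n : ℤ) => n + i) fun n => add_zero n

lemma DiffOp.mul_unit_apply (X : DiffOp N) (k : Fin N) (j m n : ℤ) (a l : Fin N) :
    X.mul (DiffOp.unit k j) m n a l = if l = k then X (m - j) n a l else 0 := by
  rw [DiffOp.mul_eq_twMul, twMul_eq_sum {m - j}]
  · simp only [Finset.sum_singleton, DiffOp.unit, sub_sub_cancel, if_true]
    split_ifs with h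
    · subst h; simp
    · simp [h]
  · intro i hi
    rw [Finset.mem_singleton] at hi
    rw [DiffOp.unit, if_neg (by omega), mul_zero]

lemma DiffOp.mul_diag_apply (X : DiffOp N) (e : Fin N → ℤ) (m n : ℤ) (a l : Fin N) :
    X.mul (DiffOp.diag e) m n a l = X (m - e l) n a l := by
  rw [DiffOp.mul_eq_twMul, twMul_eq_sum (Finset.univ.image fun l => m - e l)]
  · rw [Matrix.sum_apply, Finset.sum_eq_single (m - e l)]
    · simp [DiffOp.diag, Matrix.mul_diagonal]
    · intro i _ hi
      rw [DiffOp.diag, Matrix.mul_diagonal, if_neg (by omega), mul_zero]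
    · intro h
      exact absurd (Finset.mem_image_of_mem _ (Finset.mem_univ l)) h
  · intro i hi
    ext a l
    rw [DiffOp.diag, Matrix.mul_diagonal, if_neg, mul_zero, Matrix.zero_apply]
    intro h
    exact hi (Finset.mem_image.mpr ⟨l, Finset.mem_univ l, by omega⟩)

lemma DiffOp.diag_mul_diag (e e' : Fin N → ℤ) :
    (DiffOp.diag e).mul (DiffOp.diag e') = DiffOp.diag (e + e') := by
  funext m n
  ext a l
  rw [DiffOp.mul_diag_apply, DiffOp.diag, DiffOp.diag, Matrix.diagonal_apply, Matrix.diagonal_apply]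
  by_cases h : a = l
  · subst h
    simp only [if_true, Pi.add_apply]
    exact if_congr (by omega) rfl rfl
  · simp [h]

lemma DiffOp.mul_diag_zero (X : DiffOp N) : X.mul (DiffOp.diag 0) = X := by
  funext m n
  ext a l
  rw [DiffOp.mul_diag_apply, Pi.zero_apply, sub_zero]

lemma bddAbv_diag {e : Fin N → ℤ} {p : ℤ} (h : ∀ l, e l ≤ p) : BddAbv p (DiffOp.diag e) := by
  intro m n hm
  ext a l
  rw [DiffOp.diag, Matrix.diagonal_apply]
  have := h a
  split_ifs <;> first | rfl | omega

lemma bddBlw_diag {e : Fin N → ℤ} {p : ℤ} (h : ∀ l, p ≤ e l) : BddBlw p (DiffOp.diag e) := by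
  intro m n hm
  ext a l
  rw [DiffOp.diag, Matrix.diagonal_apply]
  have := h a
  split_ifs <;> first | rfl | omega

lemma IsGMinus.bddAbv {X : DiffOp N} (h : IsGMinus X) : BddAbv 0 X := h.1

lemma IsGPlus.bddBlw {X : DiffOp N} (h : IsGPlus X) : BddBlw 0 X := h.1

/-- In an associative class of operators, `(S₂ d S₁⁻¹)(S₁ d' R) = S₂ (d d') R`. -/
lemma telescope (B : DiffOp N → Prop) (hB : ∀ X Y, B X → B Y → B (X.mul Y))
    (assoc : ∀ X Y Z, B X → B Y → B Z → (X.mul Y).mul Z = X.mul (Y.mul Z))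
    {S₂ d Q S₁ d' R : DiffOp N} (h₂ : B S₂) (hd : B d) (hQ : B Q) (h₁ : B S₁) (hd' : B d') (hR : B R)
    (h : Q.mul S₁ = DiffOp.one N) :
    ((S₂.mul d).mul Q).mul ((S₁.mul d').mul R) = (S₂.mul (d.mul d')).mul R := by
  rw [assoc _ _ _ (hB _ _ h₂ hd) hQ (hB _ _ (hB _ _ h₁ hd') hR), assoc _ _ _ h₁ hd' hR,
    ← assoc _ _ _ hQ h₁ (hB _ _ hd' hR), h, DiffOp.one_op_mul,
    ← assoc _ _ _ (hB _ _ h₂ hd) hd' hR, assoc _ _ _ h₂ hd hd']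

/-- The one-step ratio `T(W) W⁻¹ = T(W̄) W̄⁻¹` is multiplied by a ratio already known at the earlier
point. The inner factors cancel on each side separately, among series bounded above on the left and
bounded below on the right. -/
lemma ratio_step {S₂ S₁ S₂' S₁' R R' : DiffOp N} {e f e' f' : Fin N → ℤ}
    (h₂ : BddAbv 0 S₂) (h₁ : BddAbv 0 S₁) (h₂' : BddBlw 0 S₂') (h₁' : BddBlw 0 S₁')
    (hR : BddAbv 0 R) (hR' : BddBlw 0 R')
    (h : SameRatio (S₂.mul (DiffOp.diag e)) S₁ (S₂'.mul (DiffOp.diag e')) S₁')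
    (hr : (S₁.mul (DiffOp.diag f)).mul R = (S₁'.mul (DiffOp.diag f')).mul R') :
    (S₂.mul (DiffOp.diag (e + f))).mul R = (S₂'.mul (DiffOp.diag (e' + f'))).mul R' := by
  obtain ⟨Q, Q', hQ, -, hQS, hQ', -, hQS', hq⟩ := h
  have up : ∀ e : Fin N → ℤ, ∃ p, BddAbv p (DiffOp.diag e) := fun e =>
    ⟨∑ l, |e l|, bddAbv_diag fun l => (le_abs_self _).trans
      (Finset.single_le_sum (f := fun l => |e l|) (fun _ _ => abs_nonneg _) (Finset.mem_univ l))⟩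
  have dn : ∀ e : Fin N → ℤ, ∃ p, BddBlw p (DiffOp.diag e) := fun e =>
    ⟨-∑ l, |e l|, bddBlw_diag fun l => neg_le.mp ((neg_le_abs _).trans
      (Finset.single_le_sum (f := fun l => |e l|) (fun _ _ => abs_nonneg _) (Finset.mem_univ l)))⟩
  have t := telescope (fun X : DiffOp N => ∃ p, BddAbv p X)
    (fun X Y ⟨p, hX⟩ ⟨q, hY⟩ => ⟨p + q, hX.diffOp_mul hY⟩)
    (fun X Y Z ⟨p, hX⟩ ⟨q, hY⟩ ⟨r, hZ⟩ => hX.diffOp_assoc hY hZ)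
    ⟨0, h₂⟩ (up e) ⟨0, hQ⟩ ⟨0, h₁⟩ (up f) ⟨0, hR⟩ hQS
  have t' := telescope (fun X : DiffOp N => ∃ p, BddBlw p X)
    (fun X Y ⟨p, hX⟩ ⟨q, hY⟩ => ⟨p + q, hX.diffOp_mul hY⟩)
    (fun X Y Z ⟨p, hX⟩ ⟨q, hY⟩ ⟨r, hZ⟩ => hX.diffOp_assoc hY hZ)
    ⟨0, h₂'⟩ (dn e') ⟨0, hQ'⟩ ⟨0, h₁'⟩ (dn f') ⟨0, hR'⟩ hQS'
  rw [← DiffOp.diag_mul_diag, ← t, hq, hr, t', DiffOp.diag_mul_diag]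

/-- Products are `finsum`s, which are linear only over finite supports. The set `I` is a window
common to all operators in the combination. -/
lemma mul_linearCombination {ι : Type*} (s : Finset ι) (d : ι → ℂ) (F R : DiffOp N)
    (X : ι → DiffOp N)
    (h : ∀ m n : ℤ, ∃ I : Finset ℤ, ∀ i ∉ I, F i n * R (m - i) (n + i) = 0 ∧
      ∀ k ∈ s, X k i n * R (m - i) (n + i) = 0) :
    (F - ∑ k ∈ s, d k • X k).mul R = F.mul R - ∑ k ∈ s, d k • (X k).mul R := by
  funext m n
  obtain ⟨I, hI⟩ := h m n
  have e : ∀ i, (F - ∑ k ∈ s, d k • X k) i n * R (m - i) (n + i) =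
      F i n * R (m - i) (n + i) - ∑ k ∈ s, d k • (X k i n * R (m - i) (n + i)) := by
    intro i
    simp only [Pi.sub_apply, Finset.sum_apply, Pi.smul_apply, sub_mul, Finset.sum_mul, smul_mul_assoc]
  simp only [Pi.sub_apply, Finset.sum_apply, Pi.smul_apply]
  rw [DiffOp.mul_eq_twMul, twMul_eq_sum I fun i hi => ?_, DiffOp.mul_eq_twMul,
    twMul_eq_sum I fun i hi => (hI i hi).1, Finset.sum_congr rfl fun i _ => e i,
    Finset.sum_sub_distrib, Finset.sum_comm]
  · congr 1
    refine Finset.sum_congr rfl fun k hk => ?_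
    rw [DiffOp.mul_eq_twMul, twMul_eq_sum I fun i hi => (hI i hi).2 k hk, Finset.smul_sum]
  · rw [e, (hI i hi).1, zero_sub, neg_eq_zero]
    exact Finset.sum_eq_zero fun k hk => by rw [(hI i hi).2 k hk, smul_zero]

/-- If `P R = P' R'`, where `R = S⁻¹`, `R' = S'⁻¹`, and a row of `P` has only negative, that of `P'` only
nonnegative powers of `Λ`, then both rows vanish. -/
lemma row_eq_zero {P P' S S' R R' : DiffOp N} {p p' : ℤ} {n : ℤ} {k : Fin N}
    (hP : BddAbv p P) (hP' : BddBlw p' P') (hR : BddAbv 0 R) (hR' : BddBlw 0 R')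
    (hS : BddAbv 0 S) (hS' : BddBlw 0 S') (h : P.mul R = P'.mul R')
    (hRS : R.mul S = DiffOp.one N) (hRS' : R'.mul S' = DiffOp.one N)
    (hneg : ∀ m, 0 ≤ m → ∀ l, P m n k l = 0) (hpos : ∀ m, m < 0 → ∀ l, P' m n k l = 0) :
    ∀ m l, P m n k l = 0 ∧ P' m n k l = 0 := by
  -- In degrees `m ≥ 0` the left product involves only degrees at least `m` of `P`, in degrees `m <
  -- 0` the right one only degrees at most `m` of `P'`; so the row of the common product vanishes.
  -- Multiplying back by `S` and `S'` recovers the rows of `P` and `P'`.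
  have hZ : ∀ m l, P.mul R m n k l = 0 := by
    intro m l
    rcases le_or_gt 0 m with hm | hm
    · rw [hP.diffOp_mul_eq_sum hR, Matrix.sum_apply]
      refine Finset.sum_eq_zero fun i hi => ?_
      rw [Finset.mem_Icc] at hi
      rw [Matrix.mul_apply]
      exact Finset.sum_eq_zero fun l _ => by rw [hneg i (by omega), zero_mul]
    · rw [h, hP'.diffOp_mul_eq_sum hR', Matrix.sum_apply]
      refine Finset.sum_eq_zero fun i hi => ?_
      rw [Finset.mem_Icc] at hi
      rw [Matrix.mul_apply]
      exact Finset.sum_eq_zero fun l _ => by rw [hpos i (by omega), zero_mul]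
  intro m l
  constructor
  · rw [← P.mul_one_op, ← hRS, ← hP.diffOp_assoc hR hS,
      (hP.diffOp_mul hR).diffOp_mul_eq_sum hS, Matrix.sum_apply]
    refine Finset.sum_eq_zero fun i _ => ?_
    rw [Matrix.mul_apply]
    exact Finset.sum_eq_zero fun l _ => by rw [hZ, zero_mul]
  · rw [← P'.mul_one_op, ← hRS', ← hP'.diffOp_assoc hR' hS',
      (hP'.diffOp_mul hR').diffOp_mul_eq_sum hS', Matrix.sum_apply]
    refine Finset.sum_eq_zero fun i _ => ?_
    rw [Matrix.mul_apply]
    exact Finset.sum_eq_zero fun l _ => by rw [← h, hZ, zero_mul]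

end DiffOps

lemma IsSlowOpen.eventually_setTime {N : ℕ} {D : Set (Slow N)} (hD : IsSlowOpen D) {x : Slow N}
    (hx : x ∈ D) (p : ℕ+ × Idx N) : ∀ᶠ τ in 𝓝 (x.2 p), x.setTime p τ ∈ D :=
  ((Continuous.prodMk_right x.1).tendsto (x.2 p)).eventually (hD x hx p)

lemma OnLattice.shift {N : ℕ} {ε : ℝ} {x : Slow N} (h : OnLattice ε x) (a c : Idx N) (i : ℕ) :
    OnLattice ε (x.shift (shiftVec a c) (ε * i)) := by
  intro b
  obtain ⟨m, hm⟩ := h b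
  refine ⟨m + i * ((if b = a then 1 else 0) - if b = c then 1 else 0), ?_⟩
  have : ((x.shift (shiftVec a c) (ε * i)).1 : Idx N → ℝ) b =
      (x.1 : Idx N → ℝ) b + ε * i * ((Pi.single a 1 - Pi.single c 1 : Idx N → ℝ) b) := rfl
  rw [this, hm, Pi.sub_apply, Pi.single_apply, Pi.single_apply]
  push_cast
  ring

/-! ### Time derivatives and iterated shifts of the dressing operators. -/

section Toda

variable {N : ℕ} {ε : ℝ} {D : Set (Slow N)} {S Sbar : Slow N → DiffOp N}

/-- Changing a time preserves the lattice condition and, for small changes, membership in `D`. Hence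
the normalization `S ∈ G_-` holds near the given time, where these coefficients are constant. -/
lemma IsTodaSolution.opTimeDeriv_nonneg (h : IsTodaSolution ε D S Sbar) (hD : IsSlowOpen D)
    {x : Slow N} (hx : x ∈ D) (hl : OnLattice ε x) (p : ℕ+ × Idx N) {m : ℤ} (hm : 0 ≤ m) (n : ℤ) :
    opTimeDeriv S p x m n = 0 := by
  ext k l
  change deriv (fun τ => S (x.setTime p τ) m n k l) (x.2 p) = 0
  have : (fun τ => S (x.setTime p τ) m n k l) =ᶠ[𝓝 (x.2 p)]
      fun _ => if m = 0 then (1 : Matrix (Fin N) (Fin N) ℂ) k l else 0 := by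
    filter_upwards [hD.eventually_setTime hx p] with τ hτ
    have := h.minus _ hτ hl
    split_ifs with h0
    · rw [h0, this.2]
    · rw [this.1 _ _ (by omega), Matrix.zero_apply]
  rw [this.deriv_eq, deriv_const]

lemma IsTodaSolution.opTimeDeriv_neg (h : IsTodaSolution ε D S Sbar) (hD : IsSlowOpen D)
    {x : Slow N} (hx : x ∈ D) (hl : OnLattice ε x) (p : ℕ+ × Idx N) {m : ℤ} (hm : m < 0) (n : ℤ) :
    opTimeDeriv Sbar p x m n = 0 := by
  ext k l
  change deriv (fun τ => Sbar (x.setTime p τ) m n k l) (x.2 p) = 0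
  have : (fun τ => Sbar (x.setTime p τ) m n k l) =ᶠ[𝓝 (x.2 p)] fun _ => 0 := by
    filter_upwards [hD.eventually_setTime hx p] with τ hτ
    rw [(h.plus _ hτ hl).1 _ _ hm, Matrix.zero_apply]
  rw [this.deriv_eq, deriv_const]

/-- The shifted dressing operators `T^i(W)`, `T^i(W̄)` have the same ratios to `W`, `W̄`. -/
lemma IsTodaSolution.shift_pow (h : IsTodaSolution ε D S Sbar) {x : Slow N} (hl : OnLattice ε x)
    {R R' : DiffOp N} (hR : BddAbv 0 R) (hR' : BddBlw 0 R')
    (h0 : (S x).mul R = (Sbar x).mul R') (a c : Idx N) (i : ℕ)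
    (hx : ∀ k ≤ i, x.shift (shiftVec a c) (ε * k) ∈ D) :
    ((S (x.shift (shiftVec a c) (ε * i))).mul (DiffOp.diag (i • fun k =>
      (if Sum.inl k = a then 1 else 0) - (if Sum.inl k = c then 1 else 0)))).mul R =
    ((Sbar (x.shift (shiftVec a c) (ε * i))).mul (DiffOp.diag (i • fun k =>
      (if Sum.inr k = c then 1 else 0) - (if Sum.inr k = a then 1 else 0)))).mul R' := by
  induction i with
  | zero =>
    simp only [zero_smul, DiffOp.mul_diag_zero, Nat.cast_zero, mul_zero, Slow.shift_zero]
    exact h0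
  | succ i ih =>
    have hi := hx i (by omega)
    have hi' := hx (i + 1) le_rfl
    have e : (x.shift (shiftVec a c) (ε * i)).shift (shiftVec a c) ε =
        x.shift (shiftVec a c) (ε * (i + 1 : ℕ)) := by
      rw [Slow.shift_shift]
      push_cast
      rw [mul_add, mul_one]
    have hs := h.shift _ hi (hl.shift a c i) a c (by rwa [e])
    rw [e] at hs
    rw [succ_nsmul', succ_nsmul']
    exact ratio_step (h.minus _ hi' (hl.shift a c _)).bddAbv (h.minus _ hi (hl.shift a c _)).bddAbv
      (h.plus _ hi' (hl.shift a c _)).bddBlw (h.plus _ hi (hl.shift a c _)).bddBlw hR hR' hs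
      (ih fun k hk => hx k (by omega))

end Toda

/-! ### Linear equations for the wave functions. -/

section Wave

variable {N : ℕ} [NeZero N] {ε : ℝ} {D : Set (Slow N)} {S Sbar : Slow N → DiffOp N}

/-- The amplitude of the wave function `Ψ_b`, as a Laurent series `∑ M, amplitude b M ζ^M`. -/
def amplitude (n₀ : ℤ) (S Sbar : Slow N → DiffOp N) (b : Idx N) : ShiftOp N :=
  ShiftOp.ofSeq fun i x => amp n₀ (S x) (Sbar x) b i

/-- For `M > 0` the left side is zero by truncation and the right side by `S ∈ G_-`. The offset `ν`
in columns `l ≠ 0` is harmless because at `M = 1` it meets an off-diagonal entry of the identity. -/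
lemma amplitude_inl (n₀ : ℤ) {x : Slow N} (h : IsGMinus (S x)) (l : Fin N) (M : ℤ) :
    amplitude n₀ S Sbar (Sum.inl l) M x = S x (M - nu (Sum.inl l : Idx N)) n₀ 0 l := by
  rw [amplitude, ShiftOp.ofSeq]
  split_ifs with hM
  · rw [amp, Int.toNat_of_nonneg (by omega), neg_neg]
  · rw [not_le] at hM
    by_cases hl : l = 0
    · rw [nu, if_pos hl, h.1 _ _ (by omega), Matrix.zero_apply]
    · rw [nu, if_neg hl]
      by_cases hM1 : M = 1
      · rw [hM1, sub_self, h.2, Matrix.one_apply_ne (Ne.symm hl)]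
      · rw [h.1 _ _ (by omega), Matrix.zero_apply]

lemma amplitude_inr (n₀ : ℤ) {x : Slow N} (h : IsGPlus (Sbar x)) (l : Fin N) (M : ℤ) :
    amplitude n₀ S Sbar (Sum.inr l) M x = Sbar x (-M) n₀ 0 l := by
  rw [amplitude, ShiftOp.ofSeq]
  split_ifs with hM
  · rw [amp, Int.toNat_of_nonneg (by omega)]
  · rw [h.1 _ _ (by omega), Matrix.zero_apply]

/-- The linear equations `ε ∂_{ja} Ψ_b = ∑_i d_i T^i Ψ_b`, `T = T_(a,c)`, at a point of the lattice.
The coefficients are characterized by the behaviour of the wave functions at `z = ∞` and `z = 0`. -/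
theorem IsTodaSolution.wave_equation (h : IsTodaSolution ε D S Sbar) (hD : IsSlowOpen D) (n₀ : ℤ)
    {a c : Idx N} (hac : a ≠ c) (j : ℕ+) {x : Slow N} (hl : OnLattice ε x)
    (hx : ∀ k : ℕ, k ≤ j → x.shift (shiftVec a c) (ε * k) ∈ D) (d : ℕ → ℂ)
    (hd : ∀ M : ℤ, 0 < M ∨ a = Sum.inl 0 ∧ M = 0 → ∑ i ∈ Finset.range (j + 1), d i *
      amplitude n₀ S Sbar a (M - i) (x.shift (shiftVec a c) (ε * i)) =
        amplitude n₀ S Sbar a (M - (j : ℕ)) x)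
    (hc : c = Sum.inl 0 → d 0 = 0)
    (hd0 : a ≠ Sum.inl 0 → c ≠ Sum.inl 0 → ∑ i ∈ Finset.range (j + 1), d i = 0)
    (b : Idx N) (M : ℤ) :
    ε * deriv (fun τ => amplitude n₀ S Sbar b M (x.setTime (j, a) τ)) (x.2 (j, a)) +
        (if b = a then amplitude n₀ S Sbar b (M - (j : ℕ)) x else 0) =
      ∑ i ∈ Finset.range (j + 1), d i * amplitude n₀ S Sbar b
        (M - i * ((if b = a then 1 else 0) - if b = c then 1 else 0))
        (x.shift (shiftVec a c) (ε * i)) := by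
  have hx0 : x ∈ D := by simpa [Slow.shift_zero] using hx 0 (Nat.zero_le _)
  set v := shiftVec a c with hv
  obtain ⟨R, R', hR, hSR, hRS, hR', hSR', hRS', hf⟩ := h.flow x hx0 hl (j, a)
  have hR : BddAbv 0 R := hR
  have hR' : BddBlw 0 R' := hR'
  have hS : BddAbv 0 (S x) := (h.minus x hx0 hl).bddAbv
  have hS' : BddBlw 0 (Sbar x) := (h.plus x hx0 hl).bddBlw
  have hGm : ∀ i ∈ Finset.range (j + 1), IsGMinus (S (x.shift v (ε * i))) := fun i hi =>
    h.minus _ (hx i (by rw [Finset.mem_range] at hi; omega)) (hl.shift a c i)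
  have hGp : ∀ i ∈ Finset.range (j + 1), IsGPlus (Sbar (x.shift v (ε * i))) := fun i hi =>
    h.plus _ (hx i (by rw [Finset.mem_range] at hi; omega)) (hl.shift a c i)
  set e : Fin N → ℤ := fun k =>
    (if Sum.inl k = a then 1 else 0) - (if Sum.inl k = c then 1 else 0) with he
  set e' : Fin N → ℤ := fun k =>
    (if Sum.inr k = c then 1 else 0) - (if Sum.inr k = a then 1 else 0) with he'
  set F := ε • opTimeDeriv S (j, a) x + (S x).mul (bareFlow (j, a)) with hF
  set F' := ε • opTimeDeriv Sbar (j, a) x + (Sbar x).mul (bareFlowBar (j, a)) with hF'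
  set X : ℕ → DiffOp N := fun i => (S (x.shift v (ε * i))).mul (DiffOp.diag (i • e)) with hX
  set X' : ℕ → DiffOp N := fun i => (Sbar (x.shift v (ε * i))).mul (DiffOp.diag (i • e')) with hX'
  have hFe : ∀ m n k l, F m n k l = ε * opTimeDeriv S (j, a) x m n k l +
      if Sum.inl l = a then S x (m - (j : ℕ)) n k l else 0 := by
    intro m n k l
    simp only [hF, Pi.add_apply, Pi.smul_apply, Matrix.add_apply, Matrix.smul_apply,
      Complex.real_smul]
    congr 1
    rcases a with a | a
    · simp only [bareFlow, DiffOp.mul_unit_apply, Sum.inl.injEq]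
    · simp [bareFlow, DiffOp.mul]
  have hFe' : ∀ m n k l, F' m n k l = ε * opTimeDeriv Sbar (j, a) x m n k l +
      if Sum.inr l = a then Sbar x (m + (j : ℕ)) n k l else 0 := by
    intro m n k l
    simp only [hF', Pi.add_apply, Pi.smul_apply, Matrix.add_apply, Matrix.smul_apply,
      Complex.real_smul]
    congr 1
    rcases a with a | a
    · simp [bareFlowBar, DiffOp.mul]
    · simp only [bareFlowBar, DiffOp.mul_unit_apply, Sum.inr.injEq, sub_neg_eq_add]
  have hXe : ∀ i m n k l, X i m n k l = S (x.shift v (ε * i)) (m - i * e l) n k l := by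
    intro i m n k l
    simp only [hX, DiffOp.mul_diag_apply, nsmul_eq_mul]
    rfl
  have hXe' : ∀ i m n k l, X' i m n k l = Sbar (x.shift v (ε * i)) (m - i * e' l) n k l := by
    intro i m n k l
    simp only [hX', DiffOp.mul_diag_apply, nsmul_eq_mul]
    rfl
  have hFb : BddAbv (j : ℕ) F := by
    intro m n hm
    ext k l
    rw [hFe, h.opTimeDeriv_nonneg hD hx0 hl _ (by omega), hS _ _ (by omega)]
    simp
  have hFb' : BddBlw (-(j : ℕ)) F' := by
    intro m n hm
    ext k l
    rw [hFe', h.opTimeDeriv_neg hD hx0 hl _ (by omega), hS' _ _ (by omega)]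
    simp
  have hel : ∀ (i : ℕ) (l), i * e l ≤ i ∧ -(i : ℤ) ≤ i * e l := by
    intro i l; simp only [he]; split_ifs <;> simp
  have hel' : ∀ (i : ℕ) (l), i * e' l ≤ i ∧ -(i : ℤ) ≤ i * e' l := by
    intro i l; simp only [he']; split_ifs <;> simp
  have hXb : ∀ i ∈ Finset.range (j + 1), BddAbv (j : ℕ) (X i) := by
    intro i hi m n hm
    ext k l
    have := hel i l
    rw [hXe, (hGm i hi).1 _ _ (by rw [Finset.mem_range] at hi; omega)]
  have hXb' : ∀ i ∈ Finset.range (j + 1), BddBlw (-(j : ℕ)) (X' i) := by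
    intro i hi m n hm
    ext k l
    have := hel' i l
    rw [hXe', (hGp i hi).1 _ _ (by rw [Finset.mem_range] at hi; omega)]
  have hXR : ∀ i ∈ Finset.range (j + 1), (X i).mul R = (X' i).mul R' := fun i hi =>
    h.shift_pow hl hR hR' (hSR.trans hSR'.symm) a c i fun k hk =>
      hx k (by rw [Finset.mem_range] at hi; omega)
  -- `P` and `P'` are `ε ∂W - ∑ d_i T^i(W)` and its barred analogue, multiplied on the right by the
  -- inverse of the bare factor. The conditions on `d` are designed to make `row_eq_zero` applicable
  -- to the first row at `n₀`.
  set P := F - ∑ i ∈ Finset.range (j + 1), d i • X i with hP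
  set P' := F' - ∑ i ∈ Finset.range (j + 1), d i • X' i with hP'
  have hPe : ∀ m n k l, P m n k l = F m n k l - ∑ i ∈ Finset.range (j + 1), d i * X i m n k l := by
    intro m n k l
    simp [hP, Finset.sum_apply, Matrix.sum_apply]
  have hPe' : ∀ m n k l, P' m n k l =
      F' m n k l - ∑ i ∈ Finset.range (j + 1), d i * X' i m n k l := by
    intro m n k l
    simp [hP', Finset.sum_apply, Matrix.sum_apply]
  have hPb : BddAbv (j : ℕ) P := by
    intro m n hm
    ext k l
    rw [hPe, hFb _ _ hm, Matrix.zero_apply, zero_sub, neg_eq_zero]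
    exact Finset.sum_eq_zero fun i hi => by rw [hXb i hi _ _ hm, Matrix.zero_apply, mul_zero]
  have hPb' : BddBlw (-(j : ℕ)) P' := by
    intro m n hm
    ext k l
    rw [hPe', hFb' _ _ hm, Matrix.zero_apply, zero_sub, neg_eq_zero]
    exact Finset.sum_eq_zero fun i hi => by rw [hXb' i hi _ _ hm, Matrix.zero_apply, mul_zero]
  have hPR : P.mul R = P'.mul R' := by
    rw [hP, hP', mul_linearCombination, mul_linearCombination, hf,
      Finset.sum_congr rfl fun i hi => by rw [hXR i hi]]
    · intro m n
      refine ⟨Finset.Icc (-(j : ℕ)) m, fun i hi => ?_⟩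
      rw [Finset.mem_Icc, not_and_or, not_le, not_le] at hi
      rcases hi with hi | hi
      · exact ⟨by rw [hFb' _ _ hi, zero_mul], fun k hk => by rw [hXb' k hk _ _ hi, zero_mul]⟩
      · have : R' (m - i) (n + i) = 0 := hR' _ _ (by omega)
        exact ⟨by rw [this, mul_zero], fun k _ => by rw [this, mul_zero]⟩
    · intro m n
      refine ⟨Finset.Icc m (j : ℕ), fun i hi => ?_⟩
      rw [Finset.mem_Icc, not_and_or, not_le, not_le] at hi
      rcases hi with hi | hi
      · have : R (m - i) (n + i) = 0 := hR _ _ (by omega)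
        exact ⟨by rw [this, mul_zero], fun k _ => by rw [this, mul_zero]⟩
      · exact ⟨by rw [hFb _ _ hi, zero_mul], fun k hk => by rw [hXb k hk _ _ hi, zero_mul]⟩
  -- Column `a` is the hypothesis `hd`. In column `c` the operator `T^i` lowers the degree by `i`,
  -- so only `i = 0` reaches degree 0; its first-row entry is nonzero only if `c` is the index 1,
  -- where `d 0 = 0` is needed. In the other columns only column 1 in degree 0 survives, with value
  -- `∑ d_i`.
  have hneg : ∀ m, 0 ≤ m → ∀ l, P m n₀ 0 l = 0 := by
    intro m hm l
    rw [hPe, hFe, h.opTimeDeriv_nonneg hD hx0 hl _ hm, Matrix.zero_apply, mul_zero, zero_add,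
      sub_eq_zero]
    by_cases hla : Sum.inl l = a
    · subst hla
      have hlc : ¬ Sum.inl l = c := hac
      rw [if_pos rfl]
      -- Degree `m` of `S` corresponds to the power `M = m + ν_a` of `ζ`; so `m ≥ 0` means `M ≥ 0`
      -- if `a` is the index 1 and `M > 0` for the other unbarred indices.
      have hM := hd (m + nu (Sum.inl l : Idx N)) (by
        by_cases hl0 : l = 0
        · rw [nu, if_pos hl0, hl0]; simp only [true_and]; omega
        · rw [nu, if_neg hl0]; left; omega)
      rw [amplitude_inl n₀ (h.minus x hx0 hl)] at hM
      rw [show m - ((j : ℕ) : ℤ) = m + nu (Sum.inl l : Idx N) - (j : ℕ) - nu (Sum.inl l : Idx N) by ring,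
        ← hM]
      refine Finset.sum_congr rfl fun i hi => ?_
      rw [hXe, amplitude_inl n₀ (hGm i hi)]
      simp only [he, if_true, if_neg hlc]
      congr 2
      ring
    · rw [if_neg hla]
      symm
      by_cases hlc : Sum.inl l = c
      · refine Finset.sum_eq_zero fun i hi => ?_
        have hel : e l = -1 := by simp only [he, if_neg hla, if_pos hlc, zero_sub]
        rw [hXe, hel]
        by_cases h0 : m = 0 ∧ i = 0
        · obtain ⟨rfl, rfl⟩ := h0
          by_cases hl0 : l = 0
          · rw [hc (by rw [← hlc, hl0]), zero_mul]
          · have := (hGm 0 hi).2 n₀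
            simp only [Nat.cast_zero, zero_mul, sub_zero] at this ⊢
            rw [this, Matrix.one_apply_ne (Ne.symm hl0), mul_zero]
        · rw [(hGm i hi).1 _ _ (by omega), Matrix.zero_apply, mul_zero]
      · have hel : e l = 0 := by simp only [he, if_neg hla, if_neg hlc, sub_zero]
        simp only [hXe, hel, mul_zero, sub_zero]
        rcases hm.lt_or_eq with hm | rfl
        · exact Finset.sum_eq_zero fun i hi => by
            rw [(hGm i hi).1 _ _ hm, Matrix.zero_apply, mul_zero]
        · rw [Finset.sum_congr rfl fun i hi => by rw [(hGm i hi).2], ← Finset.sum_mul]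
          by_cases hl0 : l = 0
          · subst hl0
            rw [hd0 (Ne.symm hla) (Ne.symm hlc), zero_mul]
          · rw [Matrix.one_apply_ne (Ne.symm hl0), mul_zero]
  have hpos : ∀ m, m < 0 → ∀ l, P' m n₀ 0 l = 0 := by
    intro m hm l
    rw [hPe', hFe', h.opTimeDeriv_neg hD hx0 hl _ hm, Matrix.zero_apply, mul_zero, zero_add,
      sub_eq_zero]
    by_cases hla : Sum.inr l = a
    · subst hla
      have hlc : ¬ Sum.inr l = c := hac
      rw [if_pos rfl]
      have hM := hd (-m) (by left; omega)
      rw [amplitude_inr n₀ (h.plus x hx0 hl)] at hM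
      rw [show m + ((j : ℕ) : ℤ) = -(-m - (j : ℕ)) by ring, ← hM]
      refine Finset.sum_congr rfl fun i hi => ?_
      rw [hXe', amplitude_inr n₀ (hGp i hi)]
      simp only [he', if_true, if_neg hlc]
      congr 2
      ring
    · rw [if_neg hla]
      symm
      refine Finset.sum_eq_zero fun i hi => ?_
      -- Outside column `a` the shift never lowers powers of `Λ` in the barred operator; no
      -- condition on `d` arises.
      have hel : 0 ≤ i * e' l := by
        simp only [he', if_neg hla, sub_zero]; split_ifs <;> simp
      rw [hXe', (hGp i hi).1 _ _ (by omega), Matrix.zero_apply, mul_zero]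
  have hzero := row_eq_zero hPb hPb' hR hR' hS hS' hPR hRS hRS' hneg hpos
  rcases b with l | l
  · have hz := (hzero (M - nu (Sum.inl l : Idx N)) l).1
    rw [hPe, hFe, sub_eq_zero] at hz
    have hder : deriv (fun τ => amplitude n₀ S Sbar (Sum.inl l) M (x.setTime (j, a) τ))
        (x.2 (j, a)) = opTimeDeriv S (j, a) x (M - nu (Sum.inl l : Idx N)) n₀ 0 l := by
      refine EventuallyEq.deriv_eq ?_
      filter_upwards [hD.eventually_setTime hx0 (j, a)] with τ hτ
      exact amplitude_inl n₀ (h.minus _ hτ hl) l M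
    rw [hder, amplitude_inl n₀ (h.minus x hx0 hl), sub_right_comm, hz]
    refine Finset.sum_congr rfl fun i hi => ?_
    rw [hXe, amplitude_inl n₀ (hGm i hi), sub_right_comm]
  · have hz := (hzero (-M) l).2
    rw [hPe', hFe', sub_eq_zero] at hz
    have hder : deriv (fun τ => amplitude n₀ S Sbar (Sum.inr l) M (x.setTime (j, a) τ))
        (x.2 (j, a)) = opTimeDeriv Sbar (j, a) x (-M) n₀ 0 l := by
      refine EventuallyEq.deriv_eq ?_
      filter_upwards [hD.eventually_setTime hx0 (j, a)] with τ hτ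
      exact amplitude_inr n₀ (h.plus _ hτ hl) l M
    rw [hder, amplitude_inr n₀ (h.plus x hx0 hl),
      show -(M - ((j : ℕ) : ℤ)) = -M + (j : ℕ) by ring, hz]
    refine Finset.sum_congr rfl fun i hi => ?_
    rw [hXe', amplitude_inr n₀ (hGp i hi)]
    congr 2
    simp only [he']
    ring

end Wave

/-! ### Asymptotic expansions in the slow variables -/

section Expansion

variable {N : ℕ} {D : Set (Slow N)}

/-- Convergence `ε → 0+` jointly with the charges and the time `t_p`. -/
def slowFilter (x : Slow N) (p : ℕ+ × Idx N) : Filter (ℝ × (ZeroCharge N × ℂ)) :=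
  𝓝[>] (0 : ℝ) ×ˢ 𝓝 (x.1, x.2 p)

lemma Slow.move_self (x : Slow N) (p : ℕ+ × Idx N) : x.move p (x.1, x.2 p) = x := by
  simp [Slow.move]

lemma Slow.move_move (x : Slow N) (p : ℕ+ × Idx N) (q q' : ZeroCharge N × ℂ) :
    (x.move p q).move p q' = x.move p q' := by
  simp [Slow.move]

lemma Slow.move_snd (x : Slow N) (p : ℕ+ × Idx N) (q : ZeroCharge N × ℂ) :
    (x.move p q).2 p = q.2 := by
  simp [Slow.move]

lemma Slow.setTime_move (x : Slow N) (p : ℕ+ × Idx N) (q : ZeroCharge N × ℂ) (τ : ℂ) :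
    (x.move p q).setTime p τ = x.move p (q.1, τ) := by
  simp [Slow.move, Slow.setTime]

lemma Slow.shift_eq_move (x : Slow N) (p : ℕ+ × Idx N) (v : ZeroCharge N) (r : ℝ) :
    x.shift v r = x.move p (x.1 + r • v, x.2 p) := by
  simp [Slow.move, Slow.shift]

lemma tendsto_fst_slowFilter (x : Slow N) (p : ℕ+ × Idx N) :
    Tendsto Prod.fst (slowFilter x p) (𝓝[>] 0) := tendsto_fst

lemma tendsto_snd_slowFilter (x : Slow N) (p : ℕ+ × Idx N) :
    Tendsto Prod.snd (slowFilter x p) (𝓝 (x.1, x.2 p)) := tendsto_snd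

/-- A displacement of the charges by a multiple of `ε` is absorbed by the joint limit. This makes
locally uniform expansions usable at the moving endpoints of difference quotients. -/
lemma tendsto_shift_slowFilter (x : Slow N) (p : ℕ+ × Idx N) (v : ZeroCharge N) (i : ℝ) :
    Tendsto (fun y : ℝ × (ZeroCharge N × ℂ) => (y.1, (y.2.1 + (y.1 * i) • v, y.2.2)))
      (slowFilter x p) (slowFilter x p) := by
  have h1 : Tendsto (fun y : ℝ × (ZeroCharge N × ℂ) => y.1) (slowFilter x p) (𝓝 0) :=
    (tendsto_fst_slowFilter x p).mono_right nhdsWithin_le_nhds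
  have h2 := tendsto_snd_slowFilter x p
  refine (tendsto_fst_slowFilter x p).prodMk ?_
  refine Tendsto.prodMk_nhds ?_ ((continuous_snd.tendsto _).comp h2)
  have h3 : Tendsto (fun y : ℝ × (ZeroCharge N × ℂ) => y.2.1 + (y.1 * i) • v) (slowFilter x p)
      (𝓝 (x.1 + (0 * i) • v)) :=
    ((continuous_fst.tendsto _).comp h2).add ((h1.mul_const i).smul_const v)
  simpa using h3

lemma IsSlowOpen.eventually_shift_mem (hD : IsSlowOpen D) {x : Slow N} (hx : x ∈ D)
    (p : ℕ+ × Idx N) (v : ZeroCharge N) (i : ℝ) :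
    ∀ᶠ y in slowFilter x p, (x.move p y.2).shift v (y.1 * i) ∈ D :=
  ((tendsto_snd_slowFilter x p).comp (tendsto_shift_slowFilter x p v i)).eventually (hD x hx p)

variable {f : ℝ → Slow N → ℂ} {c : ℕ → Slow N → ℂ}

lemma HasSlowExpansion.continuousAt (h : HasSlowExpansion D f c) {x : Slow N} (hx : x ∈ D)
    (p : ℕ+ × Idx N) (m : ℕ) :
    Tendsto (fun q => c m (x.move p q)) (𝓝 (x.1, x.2 p)) (𝓝 (c m x)) := by
  have := ((h x hx p).1 m).continuousAt.tendsto
  rwa [Slow.move_self] at this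

lemma HasSlowExpansion.tendsto (h : HasSlowExpansion D f c) {x : Slow N} (hx : x ∈ D)
    (p : ℕ+ × Idx N) :
    Tendsto (fun y => f y.1 (x.move p y.2)) (slowFilter x p) (𝓝 (c 0 x)) := by
  have h1 := (h x hx p).2 1
  simp only [Finset.range_one, Finset.sum_singleton, pow_zero, one_mul, pow_one] at h1
  have h2 : Tendsto (fun y : ℝ × (ZeroCharge N × ℂ) => y.1) (slowFilter x p) (𝓝 0) :=
    (tendsto_fst_slowFilter x p).mono_right nhdsWithin_le_nhds
  have h3 := (h1.trans_tendsto h2).add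
    ((h.continuousAt hx p 0).comp (tendsto_snd_slowFilter x p))
  simpa [slowFilter] using h3

lemma tendsto_slowFilter_of_fst (x : Slow N) (p : ℕ+ × Idx N) {s : ℝ → ZeroCharge N}
    (hs : Tendsto s (𝓝[>] 0) (𝓝 x.1)) :
    Tendsto (fun ε => (ε, (s ε, x.2 p))) (𝓝[>] 0) (slowFilter x p) :=
  tendsto_id.prodMk (hs.prodMk_nhds tendsto_const_nhds)

/-- The leading coefficient is the pointwise limit. -/
lemma HasSlowExpansion.tendsto_at (h : HasSlowExpansion D f c) {x : Slow N} (hx : x ∈ D)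
    (p : ℕ+ × Idx N) : Tendsto (fun ε => f ε x) (𝓝[>] 0) (𝓝 (c 0 x)) := by
  have := (h.tendsto hx p).comp (tendsto_slowFilter_of_fst x p (s := fun _ => x.1)
    tendsto_const_nhds)
  simpa [Function.comp_def, Slow.move_self] using this

lemma HasSlowExpansion.hasDerivAt_shift (h : HasSlowExpansion D f c) {x : Slow N} (hx : x ∈ D)
    (p : ℕ+ × Idx N) (v : ZeroCharge N) (m : ℕ) :
    HasDerivAt (fun r : ℝ => c m (x.shift v r))
      (fderiv ℝ (fun q : ZeroCharge N × ℂ => c m (x.move p q)) (x.1, x.2 p) (v, 0)) 0 := by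
  have h1 : HasFDerivAt (fun q : ZeroCharge N × ℂ => c m (x.move p q))
      (fderiv ℝ (fun q : ZeroCharge N × ℂ => c m (x.move p q)) (x.1, x.2 p))
      (x.1 + (0 : ℝ) • v, x.2 p) := by
    rw [zero_smul, add_zero]
    exact (((h x hx p).1 m).differentiableAt (by simp)).hasFDerivAt
  have h2 : HasDerivAt (fun r : ℝ => (x.1 + r • v, x.2 p)) (v, (0 : ℂ)) 0 := by
    refine HasDerivAt.prodMk ?_ (hasDerivAt_const _ _)
    simpa using ((hasDerivAt_id (0 : ℝ)).smul_const v).const_add x.1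
  have h3 := h1.comp_hasDerivAt (0 : ℝ) h2
  refine h3.congr_of_eventuallyEq (Eventually.of_forall fun r => ?_)
  simp only [Function.comp_apply, Slow.shift_eq_move x p]

/-- Divided differences of the `f_ε` with step `ε` converge to derivatives of the leading term. -/
lemma HasSlowExpansion.tendsto_dividedDifference (h : HasSlowExpansion D f c) {x : Slow N}
    (hx : x ∈ D) (p : ℕ+ × Idx N) (v : ZeroCharge N) (i : ℝ) {L : ℂ}
    (hL : HasDerivAt (fun r : ℝ => c 0 (x.shift v r)) L 0) :
    Tendsto (fun y => (f y.1 ((x.move p y.2).shift v (y.1 * i)) - f y.1 (x.move p y.2)) / y.1)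
      (slowFilter x p) (𝓝 (i * L)) := by
  set l := slowFilter x p with hl
  set g : ℝ × (ZeroCharge N × ℂ) → ℝ × (ZeroCharge N × ℂ) :=
    fun y => (y.1, (y.2.1 + (y.1 * i) • v, y.2.2)) with hg
  have hgt : Tendsto g l l := tendsto_shift_slowFilter x p v i
  have hgm : ∀ y, (x.move p y.2).shift v (y.1 * i) = x.move p (g y).2 := fun y => rfl
  -- The expansion is taken up to `O(ε²)`, so that its remainder still tends to zero after division
  -- by `ε`.
  set r : ℝ × (ZeroCharge N × ℂ) → ℂ := fun y =>
    f y.1 (x.move p y.2) - ∑ m ∈ Finset.range 2, (y.1 : ℂ) ^ m * c m (x.move p y.2) with hr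
  have hrO : r =O[l] fun y => y.1 ^ 2 := (h x hx p).2 2
  have hrO' : (fun y => r (g y)) =O[l] fun y => y.1 ^ 2 := hrO.comp_tendsto hgt
  have hε : Tendsto (fun y : ℝ × (ZeroCharge N × ℂ) => y.1) l (𝓝 0) :=
    (tendsto_fst_slowFilter x p).mono_right nhdsWithin_le_nhds
  have hsq : (fun y : ℝ × (ZeroCharge N × ℂ) => y.1 ^ 2) =o[l] fun y => (y.1 : ℂ) := by
    have h1 : (fun y : ℝ × (ZeroCharge N × ℂ) => y.1 * y.1) =o[l] fun y => 1 * y.1 :=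
      ((isLittleO_one_iff ℝ).mpr hε).mul_isBigO (isBigO_refl _ _)
    simp only [one_mul, ← sq] at h1
    refine h1.trans_isBigO (IsBigO.of_bound 1 (Eventually.of_forall fun y => ?_))
    simp
  have hrest : Tendsto (fun y => (r (g y) - r y) / y.1) l (𝓝 0) :=
    ((hrO'.sub hrO).trans_isLittleO hsq).tendsto_div_nhds_zero
  -- After division by `ε` the first-order term contributes a difference of values of `c 1`, which
  -- vanishes in the limit by continuity.
  have hc1 : Tendsto (fun y => c 1 (x.move p (g y).2) - c 1 (x.move p y.2)) l (𝓝 0) := by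
    have h1 := (h.continuousAt hx p 1).comp (tendsto_snd_slowFilter x p)
    simpa using (h1.comp hgt).sub h1
  set F' := fderiv ℝ (fun q : ZeroCharge N × ℂ => c 0 (x.move p q)) (x.1, x.2 p) with hF'
  have hFL : F' (v, 0) = L := (h.hasDerivAt_shift hx p v 0).unique hL
  -- The base point varies together with the step, so strict differentiability is used.
  have hstrict : HasStrictFDerivAt (fun q : ZeroCharge N × ℂ => c 0 (x.move p q)) F'
      (x.1, x.2 p) := ((h x hx p).1 0).hasStrictFDerivAt (by simp)
  have hc0 : Tendsto (fun y => (c 0 (x.move p (g y).2) - c 0 (x.move p y.2)) / y.1) l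
      (𝓝 (i * L)) := by
    have h1 := hstrict.isLittleO.comp_tendsto
      (((tendsto_snd_slowFilter x p).comp hgt).prodMk_nhds (tendsto_snd_slowFilter x p))
    have h2 : ∀ y : ℝ × (ZeroCharge N × ℂ), (g y).2 - y.2 = (y.1 * i) • (v, (0 : ℂ)) := by
      intro y
      simp [hg, Prod.ext_iff]
    have h3 : (fun y => c 0 (x.move p (g y).2) - c 0 (x.move p y.2) - y.1 * (i * L)) =o[l]
        fun y => (y.1 : ℂ) := by
      refine IsLittleO.trans_isBigO (g := fun y => (g y).2 - y.2) (h1.congr_left fun y => ?_) ?_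
      · simp only [Function.comp_apply, h2, map_smul, hFL, Complex.real_smul]
        push_cast
        ring
      · refine IsBigO.of_bound (‖i‖ * ‖(v, (0 : ℂ))‖) (Eventually.of_forall fun y => ?_)
        rw [h2, norm_smul, norm_mul, Complex.norm_real]
        exact le_of_eq (by ring)
    have h4 := h3.tendsto_div_nhds_zero.add_const (i * L)
    rw [zero_add] at h4
    refine h4.congr' ?_
    filter_upwards [(tendsto_fst_slowFilter x p).eventually self_mem_nhdsWithin] with y hy
    have hy0 : (y.1 : ℂ) ≠ 0 := Complex.ofReal_ne_zero.mpr (ne_of_gt hy)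
    field_simp
    ring
  have key := (hc0.add hc1).add hrest
  rw [add_zero, add_zero] at key
  refine key.congr' ?_
  filter_upwards [(tendsto_fst_slowFilter x p).eventually self_mem_nhdsWithin] with y hy
  have hy0 : (y.1 : ℂ) ≠ 0 := Complex.ofReal_ne_zero.mpr (ne_of_gt hy)
  have hg1 : (g y).1 = y.1 := rfl
  simp only [hgm, hr, hg1, Finset.sum_range_succ, Finset.range_zero, Finset.sum_empty, pow_zero,
    pow_one, one_mul, zero_add]
  field_simp
  ring

/-- If the `f_ε` are holomorphic in the time `t_p`, then so is the leading term, and the derivatives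
converge. -/
lemma HasSlowExpansion.tendsto_timeDeriv (h : HasSlowExpansion D f c) (hD : IsSlowOpen D)
    {ε₀ : ℝ} (hε₀ : 0 < ε₀) (p : ℕ+ × Idx N)
    (hf : ∀ ε ∈ Set.Ioo 0 ε₀, ∀ x ∈ D, DifferentiableAt ℂ (fun τ => f ε (x.setTime p τ)) (x.2 p))
    {x : Slow N} (hx : x ∈ D) {s : ℝ → ZeroCharge N} (hs : Tendsto s (𝓝[>] 0) (𝓝 x.1)) :
    DifferentiableAt ℂ (fun τ => c 0 (x.setTime p τ)) (x.2 p) ∧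
    Tendsto (fun ε => deriv (fun τ => f ε ((x.move p (s ε, x.2 p)).setTime p τ)) (x.2 p)) (𝓝[>] 0)
      (𝓝 (deriv (fun τ => c 0 (x.setTime p τ)) (x.2 p))) := by
  have hev := hD x hx p
  rw [nhds_prod_eq, eventually_prod_iff] at hev
  obtain ⟨U, hU, V, hV, hUV⟩ := hev
  obtain ⟨ρ, hρ, hball⟩ := Metric.eventually_nhds_iff_ball.mp hV
  have hU0 : U x.1 := hU.self_of_nhds
  set F : ℝ → ℂ → ℂ := fun ε τ => f ε (x.move p (s ε, τ)) with hF
  have hdiff : ∀ᶠ ε in 𝓝[>] (0 : ℝ), DifferentiableOn ℂ (F ε) (Metric.ball (x.2 p) ρ) := by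
    filter_upwards [hs.eventually hU, Ioo_mem_nhdsGT hε₀] with ε hsU hε τ hτ
    have h1 := hf ε hε _ (hUV hsU (hball τ hτ))
    simp only [Slow.setTime_move, Slow.move_snd] at h1
    exact h1.differentiableWithinAt
  -- Joint convergence in `ε` and `τ`, along the moving charges `s ε`, gives locally uniform
  -- convergence in `τ`. Weierstrass' theorem then yields both holomorphy of the limit and
  -- convergence of the derivatives.
  have hunif : TendstoLocallyUniformlyOn F (fun τ => c 0 (x.setTime p τ)) (𝓝[>] 0)
      (Metric.ball (x.2 p) ρ) := by
    rw [tendstoLocallyUniformlyOn_iff_forall_tendsto]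
    intro τ hτ
    have hxτ : x.move p (x.1, τ) ∈ D := hUV hU0 (hball τ hτ)
    have hl : Tendsto (fun y : ℝ × ℂ => (y.1, (s y.1, y.2)))
        (𝓝[>] 0 ×ˢ 𝓝[Metric.ball (x.2 p) ρ] τ) (slowFilter (x.move p (x.1, τ)) p) := by
      refine tendsto_fst.prodMk ?_
      rw [Slow.move_snd]
      exact (hs.comp tendsto_fst).prodMk_nhds (tendsto_snd.mono_right nhdsWithin_le_nhds)
    have h1 := (h.tendsto hxτ p).comp hl
    have hl' : Tendsto (fun y : ℝ × ℂ => (x.1, y.2))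
        (𝓝[>] (0 : ℝ) ×ˢ 𝓝[Metric.ball (x.2 p) ρ] τ)
        (𝓝 ((x.move p (x.1, τ)).1, (x.move p (x.1, τ)).2 p)) := by
      rw [Slow.move_snd]
      exact tendsto_const_nhds.prodMk_nhds (tendsto_snd.mono_right nhdsWithin_le_nhds)
    have h2 := (h.continuousAt hxτ p 0).comp hl'
    simp only [Function.comp_def, Slow.move_move] at h1 h2
    exact (h2.prodMk_nhds h1).mono_right (nhds_le_uniformity _)
  have hmem : x.2 p ∈ Metric.ball (x.2 p) ρ := Metric.mem_ball_self hρ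
  refine ⟨(hunif.differentiableOn hdiff Metric.isOpen_ball).differentiableAt
    (Metric.isOpen_ball.mem_nhds hmem), ?_⟩
  have h3 := (hunif.deriv hdiff Metric.isOpen_ball).tendsto_at hmem
  refine h3.congr fun ε => ?_
  simp only [Function.comp_apply, hF, Slow.setTime_move]

end Expansion

/-! ### Approximation of charges by lattice points of total charge zero. -/

section Lattice

variable {N : ℕ} [NeZero N]

/-- A point of `ε ℤ^𝒮` of total charge zero close to `s`. -/
def latticePoint (s : ZeroCharge N) (ε : ℝ) : ZeroCharge N :=
  -- Rounding down destroys neutrality. The defect is again a multiple of `ε`, is subtracted at the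
  -- index 1, and tends to the total charge of `s`, which is zero.
  ⟨fun a => ε * ⌊(s : Idx N → ℝ) a / ε⌋ -
    if a = Sum.inl 0 then ∑ b, ε * ⌊(s : Idx N → ℝ) b / ε⌋ else 0, by
    change ∑ a, (ε * (⌊(s : Idx N → ℝ) a / ε⌋ : ℝ) -
      if a = Sum.inl 0 then ∑ b, ε * (⌊(s : Idx N → ℝ) b / ε⌋ : ℝ) else 0) = 0
    rw [Finset.sum_sub_distrib, Finset.sum_ite_eq' Finset.univ (Sum.inl 0 : Idx N)]
    simp⟩

lemma onLattice_latticePoint (s : ZeroCharge N) (ε : ℝ) (t : ℕ+ × Idx N → ℂ) :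
    OnLattice ε (latticePoint s ε, t) := by
  intro a
  refine ⟨⌊(s : Idx N → ℝ) a / ε⌋ - if a = Sum.inl 0 then ∑ b, ⌊(s : Idx N → ℝ) b / ε⌋ else 0, ?_⟩
  simp only [latticePoint]
  split_ifs
  · push_cast
    rw [mul_sub, Finset.mul_sum]
  · simp

lemma tendsto_mul_floor_div (r : ℝ) : Tendsto (fun ε : ℝ => ε * ⌊r / ε⌋) (𝓝[>] 0) (𝓝 r) := by
  have h0 : Tendsto (fun ε : ℝ => r - ε) (𝓝[>] 0) (𝓝 r) := by
    have : Tendsto (fun ε : ℝ => r - ε) (𝓝 0) (𝓝 (r - 0)) := tendsto_const_nhds.sub tendsto_id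
    rw [sub_zero] at this
    exact this.mono_left nhdsWithin_le_nhds
  refine tendsto_of_tendsto_of_tendsto_of_le_of_le' h0 tendsto_const_nhds ?_ ?_
  · filter_upwards [self_mem_nhdsWithin] with ε hε
    have hε : 0 < ε := hε
    have h1 := mul_le_mul_of_nonneg_left (Int.sub_one_lt_floor (r / ε)).le hε.le
    rwa [mul_sub, mul_div_cancel₀ _ hε.ne', mul_one] at h1
  · filter_upwards [self_mem_nhdsWithin] with ε hε
    have hε : 0 < ε := hε
    have h1 := mul_le_mul_of_nonneg_left (Int.floor_le (r / ε)) hε.le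
    rwa [mul_div_cancel₀ _ hε.ne'] at h1

lemma tendsto_latticePoint (s : ZeroCharge N) : Tendsto (latticePoint s) (𝓝[>] 0) (𝓝 s) := by
  rw [tendsto_subtype_rng, tendsto_pi_nhds]
  intro a
  have hs : ∑ b, (s : Idx N → ℝ) b = 0 := s.2
  have h1 : Tendsto (fun ε : ℝ => ε * (⌊(s : Idx N → ℝ) a / ε⌋ : ℝ) -
      if a = Sum.inl 0 then ∑ b, ε * (⌊(s : Idx N → ℝ) b / ε⌋ : ℝ) else 0) (𝓝[>] 0)
      (𝓝 ((s : Idx N → ℝ) a - if a = Sum.inl 0 then ∑ b, (s : Idx N → ℝ) b else 0)) := by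
    refine (tendsto_mul_floor_div _).sub ?_
    split_ifs
    · exact tendsto_finsetSum _ fun b _ => tendsto_mul_floor_div _
    · exact tendsto_const_nhds
  rw [hs, ite_self, sub_zero] at h1
  exact h1

end Lattice

/-! ### Triangular systems -/

open PowerSeries in
/-- Dividing the relations `∑ c_i ζ^i A_i = ζ^j A` modulo negative powers of `ζ` by `A`, where
`A_i = A e_i`, in the variable `X = ζ⁻¹`. -/
lemma triangular_of_mul {A : PowerSeries ℂ} (hA : IsUnit A) (j : ℕ) (c : ℕ → ℂ)
    (e : ℕ → PowerSeries ℂ)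
    (h : ∀ r ≤ j, ∑ i ∈ Finset.range (j + 1), c i * coeff r (X ^ (j - i) * (A * e i)) = coeff r A)
    (r : ℕ) (hr : r ≤ j) :
    ∑ i ∈ Finset.range (j + 1), c i * coeff r (X ^ (j - i) * e i) = if r = 0 then 1 else 0 := by
  -- The hypotheses for `r ≤ j` say that `X ^ (j + 1)` divides `A * G`; the unit `A` can be
  -- cancelled from this divisibility.
  set G : PowerSeries ℂ := ∑ i ∈ Finset.range (j + 1), c i • (X ^ (j - i) * e i) - 1 with hG
  have h1 : X ^ (j + 1) ∣ A * G := by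
    rw [X_pow_dvd_iff]
    intro m hm
    have : A * G = ∑ i ∈ Finset.range (j + 1), c i • (X ^ (j - i) * (A * e i)) - A := by
      rw [hG, mul_sub, Finset.mul_sum, mul_one]
      congr 1
      refine Finset.sum_congr rfl fun i _ => ?_
      rw [mul_smul_comm]
      congr 1
      ring
    rw [this, map_sub, map_sum, sub_eq_zero, ← h m (by omega)]
    simp
  rw [hA.dvd_mul_left, X_pow_dvd_iff] at h1
  have h2 := h1 r (by omega)
  rw [hG, map_sub, map_sum, sub_eq_zero, coeff_one] at h2
  rw [← h2]
  simp

open PowerSeries in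
/-- Solutions of convergent triangular systems converge. -/
lemma tendsto_of_triangular {α : Type*} {l : Filter α} (j : ℕ) (c : ℕ → α → ℂ)
    (e : ℕ → α → PowerSeries ℂ) (E : ℕ → PowerSeries ℂ)
    (he : ∀ i n, Tendsto (fun y => coeff n (e i y)) l (𝓝 (coeff n (E i))))
    (hE : ∀ i, coeff 0 (E i) ≠ 0)
    (h : ∀ᶠ y in l, ∀ r ≤ j, ∑ i ∈ Finset.range (j + 1), c i y * coeff r (X ^ (j - i) * e i y) =
      if r = 0 then 1 else 0) :
    ∃ C : ℕ → ℂ, (∀ i ≤ j, Tendsto (c i) l (𝓝 (C i))) ∧ C j * coeff 0 (E j) = 1 := by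
  -- Relation `r` contains no `c i` with `i < j - r`, because of the factor `X ^ (j - i)`. It
  -- therefore expresses `c (j - r)` through the `c i` of higher index, after division by a constant
  -- coefficient with nonzero limit.
  have key : ∀ r ≤ j, ∃ C, Tendsto (c (j - r)) l (𝓝 C) := by
    intro r
    induction r using Nat.strong_induction_on with
    | _ r ih =>
      intro hr
      have ih' : ∀ i, ∃ C, i ∈ (Finset.range (j + 1)).filter (j - r < ·) →
          Tendsto (c i) l (𝓝 C) := by
        intro i
        by_cases hi : i ∈ (Finset.range (j + 1)).filter (j - r < ·)
        · rw [Finset.mem_filter, Finset.mem_range] at hi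
          obtain ⟨C, hC⟩ := ih (j - i) (by omega) (by omega)
          rw [show j - (j - i) = i by omega] at hC
          exact ⟨C, fun _ => hC⟩
        · exact ⟨0, fun h => absurd h hi⟩
      choose C hC using ih'
      have hco : ∀ i, Tendsto (fun y => coeff r (X ^ (j - i) * e i y)) l
          (𝓝 (coeff r (X ^ (j - i) * E i))) := by
        intro i
        simp only [coeff_X_pow_mul']
        split_ifs
        · exact he _ _
        · exact tendsto_const_nhds
      refine ⟨((if r = 0 then 1 else 0) - ∑ i ∈ (Finset.range (j + 1)).filter (j - r < ·),
        C i * coeff r (X ^ (j - i) * E i)) / coeff 0 (E (j - r)), ?_⟩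
      refine ((tendsto_const_nhds.sub (tendsto_finsetSum _ fun i hi =>
        (hC i hi).mul (hco i))).div (he (j - r) 0) (hE _)).congr' ?_
      filter_upwards [h, (he (j - r) 0).eventually_ne (hE _)] with y hy hy0
      simp only [Pi.div_apply] at *
      rw [div_eq_iff hy0, ← hy r hr, sub_eq_iff_eq_add,
        ← Finset.sum_filter_add_sum_filter_not _ (j - r < ·), add_comm, add_left_inj]
      rw [Finset.sum_eq_single (j - r)]
      · rw [coeff_X_pow_mul', if_pos (by omega), show r - (j - (j - r)) = 0 by omega]
      · intro i hi hne
        rw [Finset.mem_filter] at hi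
        rw [coeff_X_pow_mul', if_neg (by omega), mul_zero]
      · intro hi
        simp at hi
  have key' : ∀ i, ∃ C, i ≤ j → Tendsto (c i) l (𝓝 C) := by
    intro i
    by_cases hi : i ≤ j
    · obtain ⟨C, hC⟩ := key (j - i) (by omega)
      rw [show j - (j - i) = i by omega] at hC
      exact ⟨C, fun _ => hC⟩
    · exact ⟨0, fun h => absurd h hi⟩
  choose C hC using key'
  by_cases hl : l.NeBot
  · refine ⟨C, hC, ?_⟩
    refine tendsto_nhds_unique ((hC j le_rfl).mul (he j 0)) (tendsto_const_nhds.congr' ?_)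
    filter_upwards [h] with y hy
    have h1 := hy 0 (Nat.zero_le _)
    rw [if_pos rfl, Finset.sum_eq_single j] at h1
    · rw [Nat.sub_self, pow_zero, one_mul] at h1
      exact h1.symm
    · intro i hi hne
      rw [Finset.mem_range] at hi
      rw [coeff_X_pow_mul', if_neg (by omega), mul_zero]
    · simp
  -- Limits are not unique along the trivial filter, so there the constants are chosen to satisfy
  -- the last identity.
  · rw [not_neBot] at hl
    subst hl
    exact ⟨fun i => (coeff 0 (E j))⁻¹, fun _ _ => tendsto_bot, inv_mul_cancel₀ (hE j)⟩

/-! ### Phases of quasi-classical solutions -/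

/-- The power series part of `(𝒮_b - 𝒯_b) / ε`. -/
def phaseSeries {N : ℕ} (phase : ℝ → Idx N → Slow N → Phase) (ε : ℝ) (b : Idx N) (x : Slow N) :
    PowerSeries ℂ :=
  PowerSeries.mk fun i => (phase ε b x).coeff (-(i : ℤ)) / ε

/-- The power series part of `(𝒮_b(s + ε i v) - 𝒮_b(s)) / ε`. -/
def shiftSeries {N : ℕ} (phase : ℝ → Idx N → Slow N → Phase) (ε : ℝ) (b : Idx N) (v : ZeroCharge N) (i : ℝ)
    (x : Slow N) : PowerSeries ℂ :=
  PowerSeries.mk fun n => ((phase ε b (x.shift v (ε * i))).coeff (-(n : ℤ)) -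
    (phase ε b x).coeff (-(n : ℤ))) / ε

lemma phaseSeries_shift {N : ℕ} (phase : ℝ → Idx N → Slow N → Phase) (ε : ℝ) (b : Idx N) (v : ZeroCharge N)
    (i : ℝ) (x : Slow N) : phaseSeries phase ε b (x.shift v (ε * i)) =
      phaseSeries phase ε b x + shiftSeries phase ε b v i x := by
  ext n
  simp only [phaseSeries, shiftSeries, map_add, PowerSeries.coeff_mk]
  ring

section Phases

variable {N : ℕ} [NeZero N] {n₀ : ℤ} {ε₀ : ℝ} {D : Set (Slow N)}
  {S Sbar : ℝ → Slow N → DiffOp N} {phase : ℝ → Idx N → Slow N → Phase}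
  {term : ℕ → Idx N → Slow N → Phase}

/-- The logarithms of the phase and the bare phase agree, so the integer exponent in `Phase.IsExp`
is zero; the bare phase contributes nothing to the nonpositive coefficients. -/
lemma IsQuasiClassical.amp_eq (h : IsQuasiClassical n₀ ε₀ D S Sbar phase term) {ε : ℝ}
    (hε : ε ∈ Set.Ioo 0 ε₀) {x : Slow N} (hx : x ∈ D) (b : Idx N) :
    PowerSeries.mk (fun i => amp n₀ (S ε x) (Sbar ε x) b i) =
      expSeries (phaseSeries phase ε b x) := by
  obtain ⟨d, hd, -, hE⟩ := h.wave ε hε x hx b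
  simp only [h.log_eq ε hε x hx b, sub_self, zero_div] at hd
  have hd0 : d = 0 := by exact_mod_cast hd.symm
  rw [hd0, neg_zero, show (HahnSeries.single (0 : ℤ) (1 : ℂ)) = 1 from rfl, one_mul] at hE
  have h1 := HahnSeries.ofPowerSeries_injective hE
  rw [h1, phaseSeries]
  congr 2
  ext i
  have : (barePhase n₀ ε b x).coeff (-(i : ℤ)) = 0 := dif_neg (by omega)
  simp only [this, sub_zero]

lemma amplitude_eq_coeff (b : Idx N) (ε : ℝ) (n : ℕ) (x : Slow N) :
    amplitude n₀ (S ε) (Sbar ε) b (-(n : ℤ)) x =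
      PowerSeries.coeff n (PowerSeries.mk fun i => amp n₀ (S ε x) (Sbar ε x) b i) := by
  rw [amplitude, ShiftOp.ofSeq, if_pos (by omega), PowerSeries.coeff_mk, neg_neg, Int.toNat_natCast]

lemma IsQuasiClassical.amplitude_eq (h : IsQuasiClassical n₀ ε₀ D S Sbar phase term) {ε : ℝ}
    (hε : ε ∈ Set.Ioo 0 ε₀) {x : Slow N} (hx : x ∈ D) (b : Idx N) (n : ℕ) :
    amplitude n₀ (S ε) (Sbar ε) b (-(n : ℤ)) x =
      PowerSeries.coeff n (expSeries (phaseSeries phase ε b x)) := by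
  rw [amplitude_eq_coeff, h.amp_eq hε hx]

lemma amplitude_pos (b : Idx N) (ε : ℝ) {M : ℤ} (hM : 0 < M) (x : Slow N) :
    amplitude n₀ (S ε) (Sbar ε) b M x = 0 := by
  rw [amplitude, ShiftOp.ofSeq, if_neg (by omega)]

/-- The sign is reversed because amplitudes are indexed by powers of `ζ`, Laurent series by powers
of `ζ⁻¹`. -/
lemma IsQuasiClassical.laurent_coeff (h : IsQuasiClassical n₀ ε₀ D S Sbar phase term) {ε : ℝ}
    (hε : ε ∈ Set.Ioo 0 ε₀) {x : Slow N} (hx : x ∈ D) (b : Idx N) (n : ℤ) :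
    (HahnSeries.ofPowerSeries ℤ ℂ (expSeries (phaseSeries phase ε b x))).coeff n =
      amplitude n₀ (S ε) (Sbar ε) b (-n) x := by
  rcases lt_or_ge n 0 with hn | hn
  · rw [amplitude_pos b ε (by omega)]
    exact (PowerSeries.coeff_coe _ n).trans (if_pos hn)
  · obtain ⟨k, rfl⟩ := Int.eq_ofNat_of_zero_le hn
    rw [h.amplitude_eq hε hx, HahnSeries.ofPowerSeries_apply_coeff]

/-- The leading amplitude is an exponential. This provides the nonvanishing conditions for inverting
`𝒦`, at every point of `D`. -/
lemma IsQuasiClassical.amp_zero_ne (h : IsQuasiClassical n₀ ε₀ D S Sbar phase term) {ε : ℝ}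
    (hε : ε ∈ Set.Ioo 0 ε₀) {x : Slow N} (hx : x ∈ D) (b : Idx N) :
    amp n₀ (S ε x) (Sbar ε x) b 0 ≠ 0 := by
  have := congrArg (PowerSeries.coeff 0) (h.amp_eq hε hx b)
  rw [PowerSeries.coeff_mk, coeff_zero_expSeries] at this
  rw [this]
  exact Complex.exp_ne_zero _

end Phases

/-! ### The Hamilton-Jacobi equations -/

section HamiltonJacobi

variable {N : ℕ} [NeZero N] {n₀ : ℤ} {ε₀ : ℝ} {D : Set (Slow N)}
  {S Sbar : ℝ → Slow N → DiffOp N} {phase : ℝ → Idx N → Slow N → Phase}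
  {term : ℕ → Idx N → Slow N → Phase}

/-- The coefficient of `T^i` in the `j`-th power of the Lax operator. -/
def laxCoeff (n₀ : ℤ) (S Sbar : ℝ → Slow N → DiffOp N) (v : ZeroCharge N) (j : ℕ) (a : Idx N)
    (ε : ℝ) (i : ℤ) (x : Slow N) : ℂ :=
  ShiftOp.pow ε v (lax ε v fun i x => amp n₀ (S ε x) (Sbar ε x) a i) j i x

/-- The coefficients of `(∑ C_i T^i)_+`, where `T = T_(a,c)` and `C_i = 0` for `i > j`. -/
def projCoeff (a c : Idx N) (j : ℕ) (C : ℕ → ℂ) (i : ℕ) : ℂ :=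
  if i = 0 then if a = Sum.inl 0 then C 0 else if c = Sum.inl 0 then 0 else -∑ i ∈ Finset.Icc 1 j, C i
  else C i

lemma projCoeff_of_pos (a c : Idx N) (j : ℕ) (C : ℕ → ℂ) {i : ℕ} (hi : 0 < i) :
    projCoeff a c j C i = C i := if_neg hi.ne'

lemma projCoeff_inl_zero (c : Idx N) (j : ℕ) (C : ℕ → ℂ) :
    projCoeff (Sum.inl 0) c j C = C := by
  funext i
  rw [projCoeff, if_pos rfl]
  split_ifs with h
  · rw [h]
  · rfl

lemma tendsto_projCoeff {α : Type*} {l : Filter α} (a c : Idx N) {j : ℕ} {F : ℕ → α → ℂ}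
    {C : ℕ → ℂ} (h : ∀ i ≤ j, Tendsto (F i) l (𝓝 (C i))) {i : ℕ} (hi : i ≤ j) :
    Tendsto (fun y => projCoeff a c j (fun i => F i y) i) l (𝓝 (projCoeff a c j C i)) := by
  simp only [projCoeff]
  split_ifs
  · exact h 0 (Nat.zero_le _)
  · exact tendsto_const_nhds
  · exact (tendsto_finsetSum _ fun k hk => h k (Finset.mem_Icc.mp hk).2).neg
  · exact h i hi

lemma sum_range_succ_eq_add_sum_Icc (d : ℕ → ℂ) (j : ℕ) :
    ∑ i ∈ Finset.range (j + 1), d i = d 0 + ∑ i ∈ Finset.Icc 1 j, d i := by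
  rw [Finset.range_eq_Ico, Finset.sum_eq_sum_Ico_succ_bot (Nat.succ_pos j)]
  rfl

lemma sum_projCoeff {a c : Idx N} (ha : a ≠ Sum.inl 0) (hc : c ≠ Sum.inl 0) (j : ℕ) (C : ℕ → ℂ) :
    projCoeff a c j C 0 = -∑ i ∈ Finset.Icc 1 j, projCoeff a c j C i := by
  rw [Finset.sum_congr rfl fun i hi => projCoeff_of_pos a c j C (Finset.mem_Icc.mp hi).1,
    projCoeff, if_pos rfl, if_neg ha, if_neg hc]

lemma IsQuasiClassical.lax_relation (h : IsQuasiClassical n₀ ε₀ D S Sbar phase term) {ε : ℝ}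
    (hε : ε ∈ Set.Ioo 0 ε₀) {x : Slow N} {v : ZeroCharge N} {j : ℕ} (a : Idx N)
    (hx : ∀ k : ℤ, -(j : ℤ) ≤ k → k ≤ j → x.shift v (ε * k) ∈ D) {m : ℤ} (hm : 0 ≤ m) :
    ∑ i ∈ Finset.range (j + 1), laxCoeff n₀ S Sbar v j a ε i x *
      amplitude n₀ (S ε) (Sbar ε) a (m - i) (x.shift v (ε * i)) =
        amplitude n₀ (S ε) (Sbar ε) a (m - j) x := by
  exact lax_pow_sum (ε := ε) (v := v) (fun i x => amp n₀ (S ε x) (Sbar ε x) a i) j m hm x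
    fun k h1 h2 => h.amp_zero_ne hε (hx k h1 h2) a

-- A shifted amplitude is the unshifted one times the exponential of a difference quotient of
-- phases. Dividing the Lax relation in degree `m = j - r` by the unshifted amplitude leaves a
-- system whose data converge as `ε → 0`, although the amplitudes themselves need not.
open PowerSeries in
lemma IsQuasiClassical.lax_triangular (h : IsQuasiClassical n₀ ε₀ D S Sbar phase term) {ε : ℝ}
    (hε : ε ∈ Set.Ioo 0 ε₀) {x : Slow N} {v : ZeroCharge N} {j : ℕ} (a : Idx N)
    (hx : ∀ k : ℤ, -(j : ℤ) ≤ k → k ≤ j → x.shift v (ε * k) ∈ D) (r : ℕ) (hr : r ≤ j) :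
    ∑ i ∈ Finset.range (j + 1), laxCoeff n₀ S Sbar v j a ε i x *
      coeff r (X ^ (j - i) * expSeries (shiftSeries phase ε a v i x)) = if r = 0 then 1 else 0 := by
  have hx0 : x ∈ D := by simpa [Slow.shift_zero] using hx 0 (by omega) (by omega)
  refine triangular_of_mul (isUnit_expSeries (phaseSeries phase ε a x)) j _ _ (fun r hr => ?_) r hr
  have h1 := h.lax_relation hε a hx (m := (j : ℤ) - r) (by omega)
  rw [show (j : ℤ) - r - j = -(r : ℤ) by ring, h.amplitude_eq hε hx0] at h1
  rw [← h1]
  refine Finset.sum_congr rfl fun i hi => ?_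
  rw [Finset.mem_range] at hi
  congr 1
  have hxi : x.shift v (ε * i) ∈ D := by
    simpa using hx i (by omega) (by omega)
  rw [← expSeries_add, ← phaseSeries_shift, coeff_X_pow_mul']
  split_ifs with hir
  · rw [show (j : ℤ) - r - i = -((r - (j - i) : ℕ) : ℤ) by omega, h.amplitude_eq hε hxi]
  · rw [amplitude_pos a ε (by omega)]

/-- The derivative of the leading phase in the direction `v`. -/
def chargeDeriv (F : Slow N → Phase) (b : Idx N) (v : ZeroCharge N) (x : Slow N) : Phase where
  log := ((v : Idx N → ℝ) b : ℝ)
  coeff m := deriv (fun r : ℝ => (F (x.shift v r)).coeff m) 0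

lemma IsQuasiClassical.hasDerivAt_coeff (h : IsQuasiClassical n₀ ε₀ D S Sbar phase term)
    {x : Slow N} (hx : x ∈ D) (b : Idx N) (v : ZeroCharge N) (m : ℤ) :
    HasDerivAt (fun r : ℝ => (term 0 b (x.shift v r)).coeff m)
      ((chargeDeriv (term 0 b) b v x).coeff m) 0 :=
  ((h.coeff_expansion b m).hasDerivAt_shift hx (1, b) v 0).differentiableAt.hasDerivAt

lemma IsQuasiClassical.term_log (h : IsQuasiClassical n₀ ε₀ D S Sbar phase term) (hε₀ : 0 < ε₀)
    {x : Slow N} (hx : x ∈ D) (b : Idx N) :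
    (term 0 b x).log = (((x.1 : Idx N → ℝ) b : ℝ) : ℂ) := by
  refine tendsto_nhds_unique ((h.log_expansion b).tendsto_at hx (1, b)) ?_
  have h1 : Tendsto (fun ε : ℝ => (((x.1 : Idx N → ℝ) b + ε * (sg b * (n₀ - nu b)) : ℝ) : ℂ)) (𝓝 0)
      (𝓝 (((x.1 : Idx N → ℝ) b + 0 * (sg b * (n₀ - nu b)) : ℝ) : ℂ)) :=
    (Complex.continuous_ofReal.tendsto _).comp
      (tendsto_const_nhds.add (tendsto_id.mul_const _))
  rw [zero_mul, add_zero] at h1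
  refine (h1.mono_left nhdsWithin_le_nhds).congr' ?_
  filter_upwards [Ioo_mem_nhdsGT hε₀] with ε hε
  rw [h.log_eq ε hε x hx b]
  rfl

lemma IsQuasiClassical.term_coeff_pos (h : IsQuasiClassical n₀ ε₀ D S Sbar phase term)
    (hε₀ : 0 < ε₀) {x : Slow N} (hx : x ∈ D) (b : Idx N) {m : ℤ} (hm : 0 < m) :
    (term 0 b x).coeff m = x.2 (⟨m.toNat, by omega⟩, b) := by
  refine tendsto_nhds_unique ((h.coeff_expansion b m).tendsto_at hx (1, b)) ?_
  refine tendsto_const_nhds.congr' ?_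
  filter_upwards [Ioo_mem_nhdsGT hε₀] with ε hε
  rw [h.coeff_eq ε hε x hx b m hm]
  exact (dif_pos hm : (barePhase n₀ ε b x).coeff m = _).symm

lemma IsQuasiClassical.term_coeff_zero (h : IsQuasiClassical n₀ ε₀ D S Sbar phase term)
    (hε₀ : 0 < ε₀) {x : Slow N} (hx : x ∈ D) : (term 0 (Sum.inl 0) x).coeff 0 = 0 := by
  refine tendsto_nhds_unique ((h.coeff_expansion (Sum.inl 0) 0).tendsto_at hx (1, Sum.inl 0)) ?_
  refine tendsto_const_nhds.congr' ?_
  filter_upwards [Ioo_mem_nhdsGT hε₀] with ε hε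
  exact (h.coeff_zero ε hε x hx).symm

omit [NeZero N] in
lemma IsSlowOpen.eventually_shift (hD : IsSlowOpen D) {x : Slow N} (hx : x ∈ D) (b : Idx N)
    (v : ZeroCharge N) : ∀ᶠ r : ℝ in 𝓝 0, x.shift v r ∈ D := by
  have h1 : Tendsto (fun r : ℝ => (x.1 + r • v, x.2 (1, b))) (𝓝 0) (𝓝 (x.1, x.2 (1, b))) := by
    have : Continuous fun r : ℝ => (x.1 + r • v, x.2 (1, b)) := by fun_prop
    simpa using this.tendsto 0
  filter_upwards [h1.eventually (hD x hx (1, b))] with r hr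
  rwa [Slow.shift_eq_move x (1, b)]

lemma IsQuasiClassical.hasChargeDeriv (h : IsQuasiClassical n₀ ε₀ D S Sbar phase term)
    (hD : IsSlowOpen D) (hε₀ : 0 < ε₀) {x : Slow N} (hx : x ∈ D) (b : Idx N) (v : ZeroCharge N) :
    HasChargeDeriv (term 0 b) v x (chargeDeriv (term 0 b) b v x) := by
  refine ⟨?_, h.hasDerivAt_coeff hx b v⟩
  have h1 : HasDerivAt (fun r : ℝ => (((x.1 : Idx N → ℝ) b + r * (v : Idx N → ℝ) b : ℝ) : ℂ))
      (((v : Idx N → ℝ) b : ℝ) : ℂ) 0 := by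
    refine HasDerivAt.ofReal_comp ?_
    simpa using ((hasDerivAt_id (0 : ℝ)).mul_const ((v : Idx N → ℝ) b)).const_add
      ((x.1 : Idx N → ℝ) b)
  refine h1.congr_of_eventuallyEq ?_
  filter_upwards [hD.eventually_shift hx b v] with r hr
  rw [h.term_log hε₀ hr]
  rfl

lemma IsQuasiClassical.chargeDeriv_coeff_pos (h : IsQuasiClassical n₀ ε₀ D S Sbar phase term)
    (hD : IsSlowOpen D) (hε₀ : 0 < ε₀) {x : Slow N} (hx : x ∈ D) (b : Idx N) (v : ZeroCharge N)
    {m : ℤ} (hm : 0 < m) : (chargeDeriv (term 0 b) b v x).coeff m = 0 := by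
  refine (h.hasDerivAt_coeff hx b v m).unique ?_
  refine (hasDerivAt_const (0 : ℝ) (x.2 (⟨m.toNat, by omega⟩, b))).congr_of_eventuallyEq ?_
  filter_upwards [hD.eventually_shift hx b v] with r hr
  rw [h.term_coeff_pos hε₀ hr b hm]
  rfl

lemma IsQuasiClassical.chargeDeriv_coeff_zero (h : IsQuasiClassical n₀ ε₀ D S Sbar phase term)
    (hD : IsSlowOpen D) (hε₀ : 0 < ε₀) {x : Slow N} (hx : x ∈ D) (v : ZeroCharge N) :
    (chargeDeriv (term 0 (Sum.inl 0)) (Sum.inl 0) v x).coeff 0 = 0 := by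
  refine (h.hasDerivAt_coeff hx (Sum.inl 0) v 0).unique ?_
  refine (hasDerivAt_const (0 : ℝ) (0 : ℂ)).congr_of_eventuallyEq ?_
  filter_upwards [hD.eventually_shift hx (Sum.inl 0) v] with r hr
  rw [h.term_coeff_zero hε₀ hr]

/-- The power series part of `∂_v 𝒮_{b,0}`. -/
def chargeSeries (F : Slow N → Phase) (b : Idx N) (v : ZeroCharge N) (x : Slow N) : PowerSeries ℂ :=
  PowerSeries.mk fun i => (chargeDeriv F b v x).coeff (-(i : ℤ))

lemma IsQuasiClassical.tendsto_shiftSeries (h : IsQuasiClassical n₀ ε₀ D S Sbar phase term)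
    {x : Slow N} (hx : x ∈ D) (p : ℕ+ × Idx N) (b : Idx N) (v : ZeroCharge N) (i n : ℕ) :
    Tendsto (fun y => PowerSeries.coeff n (shiftSeries phase y.1 b v i (x.move p y.2)))
      (slowFilter x p) (𝓝 (PowerSeries.coeff n (i • chargeSeries (term 0 b) b v x))) := by
  have h1 := (h.coeff_expansion b (-(n : ℤ))).tendsto_dividedDifference hx p v i
    (h.hasDerivAt_coeff hx b v (-(n : ℤ)))
  rw [map_nsmul, chargeSeries, PowerSeries.coeff_mk, nsmul_eq_mul]
  simpa only [shiftSeries, PowerSeries.coeff_mk, Complex.ofReal_natCast] using h1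

/-- The coefficients of the Lax operators in nonnegative powers of `T` converge. -/
lemma IsQuasiClassical.exists_tendsto_laxCoeff (h : IsQuasiClassical n₀ ε₀ D S Sbar phase term)
    (hD : IsSlowOpen D) (hε₀ : 0 < ε₀) {x : Slow N} (hx : x ∈ D) (p : ℕ+ × Idx N) (v : ZeroCharge N)
    (j : ℕ) (a : Idx N) :
    ∃ C : ℕ → ℂ, (∀ i ≤ j, Tendsto (fun y => laxCoeff n₀ S Sbar v j a y.1 i (x.move p y.2))
      (slowFilter x p) (𝓝 (C i))) ∧ (a = Sum.inl 0 → C j = 1) := by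
  have hmem : ∀ᶠ y in slowFilter x p, ∀ k ∈ Finset.Icc (-(j : ℤ)) j,
      (x.move p y.2).shift v (y.1 * k) ∈ D :=
    (eventually_all_finset _).mpr fun k _ => hD.eventually_shift_mem hx p v k
  have hε : ∀ᶠ y in slowFilter x p, y.1 ∈ Set.Ioo 0 ε₀ :=
    (tendsto_fst_slowFilter x p).eventually (Ioo_mem_nhdsGT hε₀)
  have htri : ∀ᶠ y in slowFilter x p, ∀ r ≤ j, ∑ i ∈ Finset.range (j + 1),
      laxCoeff n₀ S Sbar v j a y.1 i (x.move p y.2) * PowerSeries.coeff r (PowerSeries.X ^ (j - i) *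
        expSeries (shiftSeries phase y.1 a v i (x.move p y.2))) = if r = 0 then 1 else 0 := by
    filter_upwards [hmem, hε] with y hy hyε r hr
    exact h.lax_triangular hyε a (fun k h1 h2 => hy k (Finset.mem_Icc.mpr ⟨h1, h2⟩)) r hr
  obtain ⟨C, hC, hCj⟩ :=
    tendsto_of_triangular (α := ℝ × (ZeroCharge N × ℂ)) (l := slowFilter x p) j
    (fun i y => laxCoeff n₀ S Sbar v j a y.1 i (x.move p y.2))
    (fun i y => expSeries (shiftSeries phase y.1 a v i (x.move p y.2)))
    (fun i => expSeries (i • chargeSeries (term 0 a) a v x))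
    (fun i n => tendsto_coeff_expSeries (fun n => h.tendsto_shiftSeries hx p a v i n) n)
    (fun i => by rw [coeff_zero_expSeries]; exact Complex.exp_ne_zero _) htri
  refine ⟨C, hC, ?_⟩
  rintro rfl
  -- For the index 1 the phase has no constant term, so the diagonal coefficient is `exp 0 = 1`.
  rw [coeff_zero_expSeries, map_nsmul, chargeSeries, PowerSeries.coeff_mk, Nat.cast_zero, neg_zero,
    h.chargeDeriv_coeff_zero hD hε₀ hx, smul_zero, Complex.exp_zero, mul_one] at hCj
  exact hCj

end HamiltonJacobi

/-! ### Equations for the phases and their limit. -/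

section PhaseEquation

variable {N : ℕ} [NeZero N] {n₀ : ℤ} {ε₀ : ℝ} {D : Set (Slow N)}
  {S Sbar : ℝ → Slow N → DiffOp N} {phase : ℝ → Idx N → Slow N → Phase}
  {term : ℕ → Idx N → Slow N → Phase}

/-- The exponent `v_b` of `v = e_a - e_c`. -/
def shiftExp (a c b : Idx N) : ℤ := (if b = a then 1 else 0) - if b = c then 1 else 0

omit [NeZero N] in
lemma shiftVec_apply (a c b : Idx N) : ((shiftVec a c : ZeroCharge N) : Idx N → ℝ) b = shiftExp a c b := by
  change (Pi.single a 1 - Pi.single c 1 : Idx N → ℝ) b = _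
  rw [Pi.sub_apply, Pi.single_apply, Pi.single_apply, shiftExp]
  push_cast
  rfl

/-- The chain rule for `exp(phase / ε)`; the prefactor `ε` cancels the denominator. -/
lemma IsQuasiClassical.amplitude_timeDeriv (h : IsQuasiClassical n₀ ε₀ D S Sbar phase term)
    (hD : IsSlowOpen D) {ε : ℝ} (hε : ε ∈ Set.Ioo 0 ε₀) {x : Slow N} (hx : x ∈ D) (b : Idx N)
    (p : ℕ+ × Idx N) (n : ℤ) :
    ε * deriv (fun τ => amplitude n₀ (S ε) (Sbar ε) b (-n) (x.setTime p τ)) (x.2 p) =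
      (HahnSeries.ofPowerSeries ℤ ℂ (PowerSeries.mk (fun i : ℕ =>
        deriv (fun τ => (phase ε b (x.setTime p τ)).coeff (-(i : ℤ))) (x.2 p)) *
          expSeries (phaseSeries phase ε b x))).coeff n := by
  rcases lt_or_ge n 0 with hn | hn
  · have : (fun τ => amplitude n₀ (S ε) (Sbar ε) b (-n) (x.setTime p τ)) = fun _ => 0 := by
      funext τ
      exact amplitude_pos b ε (by omega) _
    rw [this, deriv_const, mul_zero]
    exact ((PowerSeries.coeff_coe _ n).trans (if_pos hn)).symm
  · obtain ⟨k, rfl⟩ := Int.eq_ofNat_of_zero_le hn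
    have hε0 : (ε : ℂ) ≠ 0 := Complex.ofReal_ne_zero.mpr hε.1.ne'
    set f' : PowerSeries ℂ := PowerSeries.mk (fun i : ℕ =>
        deriv (fun τ => (phase ε b (x.setTime p τ)).coeff (-(i : ℤ))) (x.2 p)) with hf'
    have h1 : ∀ i, HasDerivAt (fun τ => PowerSeries.coeff i (phaseSeries phase ε b (x.setTime p τ)))
        (PowerSeries.coeff i ((ε : ℂ)⁻¹ • f')) (x.2 p) := by
      intro i
      have := (h.differentiable ε hε x hx b (-(i : ℤ)) p).hasDerivAt.div_const (ε : ℂ)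
      simp only [phaseSeries, PowerSeries.coeff_mk, hf', PowerSeries.coeff_smul]
      rwa [div_eq_inv_mul] at this
    have h2 := hasDerivAt_coeff_expSeries h1 k
    have hself : x.setTime p (x.2 p) = x := by simp [Slow.setTime]
    rw [hself] at h2
    have h3 : (fun τ => amplitude n₀ (S ε) (Sbar ε) b (-(k : ℤ)) (x.setTime p τ)) =ᶠ[𝓝 (x.2 p)]
        fun τ => PowerSeries.coeff k (expSeries (phaseSeries phase ε b (x.setTime p τ))) := by
      filter_upwards [hD.eventually_setTime hx p] with τ hτ
      exact h.amplitude_eq hε hτ b k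
    rw [h3.deriv_eq, h2.deriv, HahnSeries.ofPowerSeries_apply_coeff, smul_mul_assoc,
      PowerSeries.coeff_smul, smul_eq_mul, mul_inv_cancel_left₀ hε0]

/-- The wave equations in terms of the phases, at lattice points. -/
lemma IsQuasiClassical.phase_equation (h : IsQuasiClassical n₀ ε₀ D S Sbar phase term)
    (hD : IsSlowOpen D) {ε : ℝ} (hε : ε ∈ Set.Ioo 0 ε₀) (hT : IsTodaSolution ε D (S ε) (Sbar ε))
    {a c : Idx N} (hac : a ≠ c) (j : ℕ+) {x : Slow N} (hl : OnLattice ε x)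
    (hx : ∀ k : ℤ, -((j : ℕ) : ℤ) ≤ k → k ≤ (j : ℕ) → x.shift (shiftVec a c) (ε * k) ∈ D)
    (b : Idx N) (m : ℤ) :
    deriv (fun τ => (phase ε b (x.setTime (j, a) τ)).coeff m) (x.2 (j, a)) =
      ∑ i ∈ Finset.range (j + 1),
        projCoeff a c j (fun i => laxCoeff n₀ S Sbar (shiftVec a c) j a ε i x) i *
        (HahnSeries.single (-(i * shiftExp a c b)) 1 * HahnSeries.ofPowerSeries ℤ ℂ
          (expSeries (shiftSeries phase ε b (shiftVec a c) i x))).coeff (-m) := by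
  have hx0 : x ∈ D := by simpa [Slow.shift_zero] using hx 0 (by omega) (by omega)
  set v := shiftVec a c with hv
  set d := projCoeff a c j (fun i => laxCoeff n₀ S Sbar v j a ε i x) with hd
  have hxi : ∀ k : ℕ, k ≤ j → x.shift v (ε * k) ∈ D := fun k hk => by
    simpa using hx k (by omega) (by omega)
  have hw := hT.wave_equation hD n₀ hac j hl hxi d ?_ ?_ ?_
  rotate_left
  · intro M hM
    rw [← h.lax_relation hε a hx (by omega : 0 ≤ M)]
    refine Finset.sum_congr rfl fun i hi => ?_
    -- For `M > 0` the term `i = 0` has a vanishing amplitude, so the modification of `d 0` by the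
    -- projection does no harm. The relation for `M = 0` is needed only for the index 1, where
    -- nothing is modified.
    rcases hM with hM | ⟨rfl, rfl⟩
    · rcases Nat.eq_zero_or_pos i with rfl | hi0
      · rw [amplitude_pos a ε (by simpa using hM), mul_zero, mul_zero]
      · rw [hd, projCoeff_of_pos _ _ _ _ hi0]
    · rw [hd, projCoeff_inl_zero]
  · rintro rfl
    rw [hd, projCoeff, if_pos rfl, if_neg hac, if_pos rfl]
  · intro ha hc
    rw [sum_range_succ_eq_add_sum_Icc, hd, sum_projCoeff ha hc, neg_add_cancel]
  set A := HahnSeries.ofPowerSeries ℤ ℂ (expSeries (phaseSeries phase ε b x)) with hA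
  have hA0 : A ≠ 0 := ((isUnit_expSeries _).map _).ne_zero
  set f' : PowerSeries ℂ := PowerSeries.mk (fun i : ℕ =>
    deriv (fun τ => (phase ε b (x.setTime (j, a) τ)).coeff (-(i : ℤ))) (x.2 (j, a))) with hf'
  -- The wave equation divided by the amplitude. On the left, `f'` is the nonpositive part of
  -- `∂𝒮_b`, and the extra `single` term is `ζ^j`, the derivative of the bare phase when `b = a`.
  have hL : HahnSeries.ofPowerSeries ℤ ℂ f' +
      (if b = a then HahnSeries.single (-((j : ℕ) : ℤ)) 1 else 0) =
      ∑ i ∈ Finset.range (j + 1), HahnSeries.C (d i) * (HahnSeries.single (-(i * shiftExp a c b)) 1 *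
        HahnSeries.ofPowerSeries ℤ ℂ (expSeries (shiftSeries phase ε b v i x))) := by
    refine mul_right_cancel₀ hA0 ?_
    rw [add_mul, Finset.sum_mul, hA, ← map_mul, ← hA]
    ext n
    rw [HahnSeries.coeff_add, ← h.amplitude_timeDeriv hD hε hx0, HahnSeries.coeff_sum]
    have e1 : ((if b = a then HahnSeries.single (-((j : ℕ) : ℤ)) 1 else 0) * A).coeff n =
        if b = a then amplitude n₀ (S ε) (Sbar ε) b (-n - (j : ℕ)) x else 0 := by
      split_ifs with hba
      · rw [HahnSeries.coeff_single_mul, one_mul, hA, h.laurent_coeff hε hx0]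
        congr 1
        ring
      · rw [zero_mul, HahnSeries.coeff_zero]
    rw [e1, hw]
    refine Finset.sum_congr rfl fun i hi => ?_
    rw [mul_assoc, HahnSeries.C_mul_eq_smul, HahnSeries.coeff_smul, smul_eq_mul, mul_assoc, hA, ← map_mul,
      mul_comm (expSeries _), ← expSeries_add, ← phaseSeries_shift, HahnSeries.coeff_single_mul,
      one_mul, h.laurent_coeff hε (hxi i (by rw [Finset.mem_range] at hi; omega))]
    congr 2
    rw [shiftExp]
    ring
  have hLm := congrArg (fun s => HahnSeries.coeff s (-m)) hL
  simp only [HahnSeries.coeff_add, HahnSeries.coeff_sum, HahnSeries.C_mul_eq_smul,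
    HahnSeries.coeff_smul, smul_eq_mul] at hLm
  rw [← hLm]
  rcases le_or_gt m 0 with hm | hm
  · obtain ⟨k, hk⟩ := Int.eq_ofNat_of_zero_le (show 0 ≤ -m by omega)
    obtain rfl : m = -(k : ℤ) := by omega
    have e1 : (if b = a then HahnSeries.single (-((j : ℕ) : ℤ)) (1 : ℂ) else 0).coeff (k : ℤ) = 0 := by
      split_ifs
      · exact HahnSeries.coeff_single_of_ne (by have := j.pos; omega)
      · rfl
    rw [neg_neg, e1, add_zero, HahnSeries.ofPowerSeries_apply_coeff, hf', PowerSeries.coeff_mk]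
  · have e1 : (HahnSeries.ofPowerSeries ℤ ℂ f').coeff (-m) = 0 :=
      (PowerSeries.coeff_coe _ _).trans (if_pos (by omega))
    -- Positive coefficients of the phase are the times themselves, and only `t_{ja}` varies.
    have e2 : (fun τ => (phase ε b (x.setTime (j, a) τ)).coeff m) =ᶠ[𝓝 (x.2 (j, a))]
        fun τ => if b = a ∧ m = (j : ℕ) then τ else x.2 (⟨m.toNat, by omega⟩, b) := by
      filter_upwards [hD.eventually_setTime hx0 (j, a)] with τ hτ
      rw [h.coeff_eq ε hε _ hτ b m hm]
      refine (dif_pos hm).trans ?_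
      simp only [Slow.setTime, Function.update_apply]
      refine if_congr ?_ rfl rfl
      refine Prod.ext_iff.trans (and_comm.trans (and_congr_right fun _ => ?_))
      refine PNat.coe_inj.symm.trans ?_
      change m.toNat = (j : ℕ) ↔ _
      omega
    rw [e1, zero_add, e2.deriv_eq]
    by_cases hba : b = a
    · by_cases hmj : m = (j : ℕ)
      · simp [hba, hmj]
      · rw [if_pos hba, HahnSeries.coeff_single_of_ne (by omega)]
        simp [hmj]
    · simp [hba]

/-- The derivative of the leading phase with respect to a time. -/
def timeDeriv (F : Slow N → Phase) (p : ℕ+ × Idx N) (x : Slow N) : Phase where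
  log := 0
  coeff m := deriv (fun τ => (F (x.setTime p τ)).coeff m) (x.2 p)

/-- The Hamilton-Jacobi equations for the shift `T_(a,c)`. -/
theorem IsQuasiClassical.hamiltonJacobi (h : IsQuasiClassical n₀ ε₀ D S Sbar phase term)
    (hD : IsSlowOpen D) (hε₀ : 0 < ε₀)
    (hT : ∀ ε ∈ Set.Ioo 0 ε₀, IsTodaSolution ε D (S ε) (Sbar ε))
    {a c : Idx N} (hac : a ≠ c) (j : ℕ+) {x : Slow N} (hx : x ∈ D) {C : ℕ → ℂ}
    (hC : ∀ i ≤ (j : ℕ), Tendsto (fun y => laxCoeff n₀ S Sbar (shiftVec a c) j a y.1 i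
      (x.move (j, a) y.2)) (slowFilter x (j, a)) (𝓝 (C i))) {P : Polynomial ℂ}
    (hP : P.natDegree ≤ j) (hPC : ∀ i ≤ (j : ℕ), P.coeff i = projCoeff a c j C i) (b : Idx N) :
    HamiltonJacobi (term 0 b) j a (shiftVec a c) P x := by
  set v := shiftVec a c with hv
  have hs := tendsto_latticePoint x.1
  have hdiff := fun m => (h.coeff_expansion b m).tendsto_timeDeriv hD hε₀ (j, a)
    (fun ε hε x hx => h.differentiable ε hε x hx b m (j, a)) hx hs
  -- The logarithmic part of `∂_v 𝒮_{b,0}` has the integer coefficient `v_b`, so its exponential is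
  -- a Laurent series; the factor `ζ^{v_b}` has exponent `-v_b` in the variable `ζ⁻¹`.
  set E : LaurentSeries ℂ := HahnSeries.single (-shiftExp a c b) 1 *
    HahnSeries.ofPowerSeries ℤ ℂ (expSeries (chargeSeries (term 0 b) b v x)) with hE
  refine ⟨timeDeriv (term 0 b) (j, a) x, chargeDeriv (term 0 b) b v x, Polynomial.aeval E P, E,
    ⟨?_, fun m => (hdiff m).1.hasDerivAt⟩, h.hasChargeDeriv hD hε₀ hx b v, ⟨rfl, fun m => ?_⟩,
    ⟨shiftExp a c b, ?_, fun m hm => h.chargeDeriv_coeff_pos hD hε₀ hx b v hm, rfl⟩, rfl⟩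
  · refine (hasDerivAt_const _ (((x.1 : Idx N → ℝ) b : ℝ) : ℂ)).congr_of_eventuallyEq ?_
    filter_upwards [hD.eventually_setTime hx (j, a)] with τ hτ
    rw [h.term_log hε₀ hτ]
    rfl
  · have hEpow : ∀ i : ℕ, E ^ i = HahnSeries.single (-(i * shiftExp a c b)) 1 *
        HahnSeries.ofPowerSeries ℤ ℂ (expSeries (i • chargeSeries (term 0 b) b v x)) := by
      intro i
      rw [hE, mul_pow, HahnSeries.single_pow, one_pow, expSeries_nsmul, map_pow, nsmul_eq_mul,
        mul_neg]
    have hrhs : (Polynomial.aeval E P).coeff (-m) = ∑ i ∈ Finset.range (j + 1),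
        projCoeff a c j C i * (HahnSeries.single (-(i * shiftExp a c b)) 1 *
        HahnSeries.ofPowerSeries ℤ ℂ (expSeries (i • chargeSeries (term 0 b) b v x))).coeff (-m) := by
      rw [Polynomial.aeval_def, Polynomial.eval₂_eq_sum_range' _ (Nat.lt_succ_of_le hP),
        HahnSeries.coeff_sum]
      refine Finset.sum_congr rfl fun i hi => ?_
      rw [Finset.mem_range] at hi
      rw [hPC i (by omega), hEpow, LaurentSeries.algebraMap_apply, HahnSeries.C_mul_eq_smul,
        HahnSeries.coeff_smul, smul_eq_mul]
    rw [hrhs]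
    -- The phase equation is taken at the lattice points approximating `x.1`. Its two sides converge
    -- to the two sides of the claim.
    refine tendsto_nhds_unique (hdiff m).2 ?_
    have hy := tendsto_slowFilter_of_fst x (j, a) hs
    have hcoeff : ∀ i : ℕ, Tendsto (fun ε => (HahnSeries.single (-(i * shiftExp a c b)) 1 *
        HahnSeries.ofPowerSeries ℤ ℂ (expSeries (shiftSeries phase ε b v i
          (x.move (j, a) (latticePoint x.1 ε, x.2 (j, a)))))).coeff (-m)) (𝓝[>] 0)
        (𝓝 ((HahnSeries.single (-(i * shiftExp a c b)) 1 *
        HahnSeries.ofPowerSeries ℤ ℂ (expSeries (i • chargeSeries (term 0 b) b v x))).coeff (-m))) := by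
      intro i
      simp only [HahnSeries.coeff_single_mul, one_mul]
      rcases lt_or_ge (-m - -(i * shiftExp a c b)) 0 with hn | hn
      · have hz : ∀ s : PowerSeries ℂ,
            (HahnSeries.ofPowerSeries ℤ ℂ s).coeff (-m - -(i * shiftExp a c b)) = 0 := fun s =>
          (PowerSeries.coeff_coe s _).trans (if_pos hn)
        simp only [hz]
        exact tendsto_const_nhds
      · obtain ⟨k, hk⟩ := Int.eq_ofNat_of_zero_le hn
        simp only [hk, HahnSeries.ofPowerSeries_apply_coeff]
        exact tendsto_coeff_expSeries
          (fun n => (h.tendsto_shiftSeries hx (j, a) b v i n).comp hy) k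
    have hlim : Tendsto (fun ε => ∑ i ∈ Finset.range (j + 1),
        projCoeff a c j (fun i => laxCoeff n₀ S Sbar v j a ε i
          (x.move (j, a) (latticePoint x.1 ε, x.2 (j, a)))) i *
        (HahnSeries.single (-(i * shiftExp a c b)) 1 *
        HahnSeries.ofPowerSeries ℤ ℂ (expSeries (shiftSeries phase ε b v i
          (x.move (j, a) (latticePoint x.1 ε, x.2 (j, a)))))).coeff (-m)) (𝓝[>] 0)
        (𝓝 (∑ i ∈ Finset.range (j + 1),
        projCoeff a c j C i * (HahnSeries.single (-(i * shiftExp a c b)) 1 *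
        HahnSeries.ofPowerSeries ℤ ℂ (expSeries (i • chargeSeries (term 0 b) b v x))).coeff (-m))) := by
      refine tendsto_finsetSum _ fun i hi => Tendsto.mul ?_ (hcoeff i)
      rw [Finset.mem_range] at hi
      exact tendsto_projCoeff a c (fun i hi => (hC i hi).comp hy) (by omega)
    refine hlim.congr' ?_
    have hmem : ∀ᶠ y in slowFilter x (j, a), ∀ k ∈ Finset.Icc (-((j : ℕ) : ℤ)) (j : ℕ),
        (x.move (j, a) y.2).shift v (y.1 * k) ∈ D :=
      (eventually_all_finset _).mpr fun k _ => hD.eventually_shift_mem hx (j, a) v k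
    filter_upwards [hy.eventually hmem, Ioo_mem_nhdsGT hε₀] with ε hε1 hε
    have heq := h.phase_equation hD hε (hT ε hε) hac j
      (x := x.move (j, a) (latticePoint x.1 ε, x.2 (j, a)))
      (onLattice_latticePoint x.1 ε _) (fun k h1 h2 => hε1 k (Finset.mem_Icc.mpr ⟨h1, h2⟩)) b m
    rw [Slow.move_snd] at heq
    exact heq.symm
  · rw [chargeDeriv, hv, shiftVec_apply]
    push_cast
    rfl

/-- Existence of the limit symbols for the shift `T_(a,c)`, with the Hamilton-Jacobi equations. -/
theorem IsQuasiClassical.exists_symbol (h : IsQuasiClassical n₀ ε₀ D S Sbar phase term)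
    (hD : IsSlowOpen D) (hε₀ : 0 < ε₀)
    (hT : ∀ ε ∈ Set.Ioo 0 ε₀, IsTodaSolution ε D (S ε) (Sbar ε))
    {a c : Idx N} (hac : a ≠ c) (j : ℕ+) {x : Slow N} (hx : x ∈ D) :
    ∃ P : Polynomial ℂ, (∀ i : ℕ, Tendsto (fun ε => if i ≤ j then projCoeff a c j
        (fun i => laxCoeff n₀ S Sbar (shiftVec a c) j a ε i x) i else 0) (𝓝[>] 0) (𝓝 (P.coeff i))) ∧
      P.natDegree ≤ j ∧ (a = Sum.inl 0 → P.coeff j = 1) ∧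
      (a ≠ Sum.inl 0 → c = Sum.inl 0 → P.coeff 0 = 0) ∧
      (a ≠ Sum.inl 0 → c ≠ Sum.inl 0 → P.coeff 0 = -∑ i ∈ Finset.Icc 1 (j : ℕ), P.coeff i) ∧
      ∀ b, HamiltonJacobi (term 0 b) j a (shiftVec a c) P x := by
  obtain ⟨C, hC, hC1⟩ := h.exists_tendsto_laxCoeff hD hε₀ hx (j, a) (shiftVec a c) j a
  set P : Polynomial ℂ :=
    ∑ i ∈ Finset.range (j + 1), Polynomial.monomial i (projCoeff a c j C i) with hP
  have hcoeff : ∀ i, P.coeff i = if i ≤ j then projCoeff a c j C i else 0 := by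
    intro i
    simp only [hP, Polynomial.finsetSum_coeff, Polynomial.coeff_monomial, Finset.sum_ite_eq',
      Finset.mem_range, Nat.lt_succ_iff]
  have hdeg : P.natDegree ≤ j := by
    rw [Polynomial.natDegree_le_iff_coeff_eq_zero]
    intro i hi
    rw [hcoeff, if_neg (by omega)]
  -- The coefficients converge at the fixed point `x` itself: unlike the wave equations, the Lax
  -- relation requires no lattice condition.
  have hy := tendsto_slowFilter_of_fst x (j, a) (s := fun _ => x.1) tendsto_const_nhds
  have hPC : ∀ i ≤ (j : ℕ), P.coeff i = projCoeff a c j C i := fun i hi => by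
    rw [hcoeff, if_pos hi]
  refine ⟨P, fun i => ?_, hdeg, ?_, ?_, ?_, fun b => h.hamiltonJacobi hD hε₀ hT hac j hx hC hdeg hPC b⟩
  · rw [hcoeff]
    split_ifs with hi
    · have := tendsto_projCoeff a c (fun i hi => (hC i hi).comp hy) hi
      simpa only [Function.comp_def, Slow.move_self] using this
    · exact tendsto_const_nhds
  · intro ha
    rw [hPC _ le_rfl, projCoeff_of_pos _ _ _ _ j.pos, hC1 ha]
  · intro ha hc
    rw [hPC _ (Nat.zero_le _), projCoeff, if_pos rfl, if_neg ha, if_pos hc]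
  · intro ha hc
    rw [hPC _ (Nat.zero_le _), sum_projCoeff ha hc]
    congr 1
    exact Finset.sum_congr rfl fun i hi => (hPC i (Finset.mem_Icc.mp hi).2).symm

/-! ### The projections of the Lax powers in terms of `projCoeff`. -/

lemma laxCoeff_eq_zero (n₀ : ℤ) (S Sbar : ℝ → Slow N → DiffOp N) (v : ZeroCharge N) (j : ℕ)
    (a : Idx N) (ε : ℝ) {i : ℤ} (hi : (j : ℤ) < i) (x : Slow N) :
    laxCoeff n₀ S Sbar v j a ε i x = 0 := bddAbv_pow (bddAbv_lax _) j i x hi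

/-- For the unbarred shifts `c` is the index 1 whenever `a` is not, so the constant term is either
kept or dropped and the third case of `projCoeff` does not occur. -/
lemma laxPlus_eq (n₀ : ℤ) {a₀ a c : Idx N} (hc : c = if a = Sum.inl 0 then a₀ else Sum.inl 0)
    (S Sbar : ℝ → Slow N → DiffOp N) (ε : ℝ) (j : ℕ+) (i : ℕ) (x : Slow N) :
    laxPlus n₀ a₀ S Sbar ε j a i x = if i ≤ j then projCoeff a c j
        (fun i => laxCoeff n₀ S Sbar (dir a₀ a) j a ε i x) i else 0 := by
  have hz : ¬ i ≤ j → laxCoeff n₀ S Sbar (dir a₀ a) j a ε i x = 0 := fun h =>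
    laxCoeff_eq_zero _ _ _ _ _ _ _ (by omega) _
  unfold laxPlus plus
  by_cases ha : a = Sum.inl 0
  · subst ha
    rw [if_pos rfl, ShiftOp.nonneg, if_pos (by omega), projCoeff_inl_zero]
    split_ifs with h
    · rfl
    · exact hz h
  · rw [if_neg ha] at hc ⊢
    rw [ShiftOp.pos]
    rcases Nat.eq_zero_or_pos i with rfl | hi
    · rw [if_neg (by simp), if_pos (Nat.zero_le _), projCoeff, if_pos rfl, if_neg ha, if_pos hc]
    · rw [if_pos (by omega), projCoeff_of_pos _ _ _ _ hi]
      split_ifs with h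
      · rfl
      · exact hz h

lemma finsum_pos_eq_sum_Icc {f : ℤ → ℂ} {j : ℕ} (hf : ∀ i : ℤ, (j : ℤ) < i → f i = 0) :
    ∑ᶠ (i : ℤ) (_ : 0 < i), f i = ∑ i ∈ Finset.Icc 1 j, f i := by
  refine (finsum_mem_eq_sum_of_inter_support_eq (s := {i : ℤ | 0 < i}) f
    (t := (Finset.Icc 1 j).map Nat.castEmbedding) ?_).trans ?_
  rotate_left
  · rw [Finset.sum_map]
    rfl
  · ext i
    simp only [Set.mem_inter_iff, Set.mem_ofPred_eq, Function.mem_support, Finset.coe_map,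
      Set.mem_image, Finset.mem_coe, Finset.mem_Icc, Nat.castEmbedding_apply]
    constructor
    · rintro ⟨h1, h2⟩
      have : ¬ (j : ℤ) < i := fun h => h2 (hf i h)
      exact ⟨⟨i.toNat, by omega, by omega⟩, h2⟩
    · rintro ⟨⟨k, hk, rfl⟩, h2⟩
      exact ⟨by omega, h2⟩

/-- Here `c` is the index 1 exactly when `a = 1̄` and the auxiliary index is 1. Otherwise, for `a ≠
1`, the term of degree 0 is minus the sum of the positive coefficients, a finite sum because the Lax
power has order at most `j`. -/
lemma laxPlusBar_eq (n₀ : ℤ) {a₀ a c : Idx N} (hc : c = if a = Sum.inr 0 then a₀ else Sum.inr 0)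
    (S Sbar : ℝ → Slow N → DiffOp N) (ε : ℝ) (j : ℕ+) (i : ℕ) (x : Slow N) :
    laxPlusBar n₀ a₀ S Sbar ε j a i x = if i ≤ j then projCoeff a c j
        (fun i => laxCoeff n₀ S Sbar (dirBar a₀ a) j a ε i x) i else 0 := by
  have hz : ¬ i ≤ j → laxCoeff n₀ S Sbar (dirBar a₀ a) j a ε i x = 0 := fun h =>
    laxCoeff_eq_zero _ _ _ _ _ _ _ (by omega) _
  have hc0 : c = Sum.inl 0 ↔ a = Sum.inr 0 ∧ a₀ = Sum.inl 0 := by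
    rw [hc]
    split_ifs with h <;> simp [h]
  unfold laxPlusBar plusBar
  by_cases ha : a = Sum.inl 0
  · subst ha
    rw [if_pos rfl, ShiftOp.nonneg, if_pos (by omega), projCoeff_inl_zero]
    split_ifs with h
    · rfl
    · exact hz h
  · rw [if_neg ha]
    rcases Nat.eq_zero_or_pos i with rfl | hi
    · rw [if_pos (Nat.zero_le _), projCoeff, if_pos rfl, if_neg ha]
      by_cases hc1 : c = Sum.inl 0
      · rw [if_pos (hc0.mp hc1), if_pos hc1, ShiftOp.pos, if_neg (by simp)]
      · rw [if_neg (hc0.not.mp hc1), if_neg hc1, ShiftOp.posSubOne, if_neg (by simp), if_pos (by simp)]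
        congr 1
        exact finsum_pos_eq_sum_Icc (f := fun i => laxCoeff n₀ S Sbar (dirBar a₀ a) j a ε i x)
          fun i hi => laxCoeff_eq_zero _ _ _ _ _ _ _ hi _
    · have e : ∀ Q : ShiftOp N, (if a = Sum.inr 0 ∧ a₀ = Sum.inl 0 then Q.pos else Q.posSubOne) i x =
          Q i x := by
        intro Q
        split_ifs
        · rw [ShiftOp.pos, if_pos (by omega)]
        · rw [ShiftOp.posSubOne, if_pos (by omega)]
      rw [e, projCoeff_of_pos _ _ _ _ hi]
      split_ifs with h
      · rfl
      · exact hz h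

end PhaseEquation

end TodaWhitham

end

/-! ### The Hamilton–Jacobi equations for both families of shifts. -/

theorem mainTheorem7 {N : ℕ} [NeZero N] (n₀ : ℤ)
    (a₀ : TodaWhitham.Idx N) (ha₀ : a₀ ≠ Sum.inl 0)
    (a₀' : TodaWhitham.Idx N) (ha₀' : a₀' ≠ Sum.inr 0)
    (D : Set (TodaWhitham.Slow N)) (hD : TodaWhitham.IsSlowOpen D)
    (ε₀ : ℝ) (hε₀ : 0 < ε₀)
    (S Sbar : ℝ → TodaWhitham.Slow N → TodaWhitham.DiffOp N)
    (hToda : ∀ ε ∈ Set.Ioo 0 ε₀, TodaWhitham.IsTodaSolution ε D (S ε) (Sbar ε))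
    (phase : ℝ → TodaWhitham.Idx N → TodaWhitham.Slow N → TodaWhitham.Phase)
    (term : ℕ → TodaWhitham.Idx N → TodaWhitham.Slow N → TodaWhitham.Phase)
    (hphase : TodaWhitham.IsQuasiClassical n₀ ε₀ D S Sbar phase term) :
    ∃ P Pbar : ℕ+ → TodaWhitham.Idx N → TodaWhitham.Slow N → Polynomial ℂ,
      ∀ (j : ℕ+) (a : TodaWhitham.Idx N), ∀ x ∈ D,
        (TodaWhitham.IsLimitSymbol (fun ε => TodaWhitham.laxPlus n₀ a₀ S Sbar ε j a) x (P j a x) ∧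
          (P j a x).natDegree ≤ j ∧
          (a = Sum.inl 0 → (P j a x).coeff j = 1) ∧
          (a ≠ Sum.inl 0 → (P j a x).coeff 0 = 0) ∧
          ∀ b, TodaWhitham.HamiltonJacobi (term 0 b) j a (TodaWhitham.dir a₀ a) (P j a x) x) ∧
        (TodaWhitham.IsLimitSymbol (fun ε => TodaWhitham.laxPlusBar n₀ a₀' S Sbar ε j a) x
            (Pbar j a x) ∧
          (Pbar j a x).natDegree ≤ j ∧
          (a = Sum.inl 0 → (Pbar j a x).coeff j = 1) ∧
          (a = Sum.inr 0 → a₀' = Sum.inl 0 → (Pbar j a x).coeff 0 = 0) ∧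
          (a ≠ Sum.inl 0 → ¬(a = Sum.inr 0 ∧ a₀' = Sum.inl 0) →
            (Pbar j a x).coeff 0 = -∑ i ∈ Finset.Icc 1 (j : ℕ), (Pbar j a x).coeff i) ∧
          ∀ b, TodaWhitham.HamiltonJacobi (term 0 b) j a (TodaWhitham.dirBar a₀' a)
            (Pbar j a x) x) := by
  open TodaWhitham in
  -- Placing the hypothesis `x ∈ D` inside the existential makes the chosen polynomials total
  -- functions of `x`; they are zero outside `D`.
  have hex : ∀ (j : ℕ+) (a : Idx N) (x : Slow N), ∃ P Pbar : Polynomial ℂ, x ∈ D →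
      (IsLimitSymbol (fun ε => laxPlus n₀ a₀ S Sbar ε j a) x P ∧
        P.natDegree ≤ j ∧ (a = Sum.inl 0 → P.coeff j = 1) ∧ (a ≠ Sum.inl 0 → P.coeff 0 = 0) ∧
        ∀ b, HamiltonJacobi (term 0 b) j a (dir a₀ a) P x) ∧
      (IsLimitSymbol (fun ε => laxPlusBar n₀ a₀' S Sbar ε j a) x Pbar ∧
        Pbar.natDegree ≤ j ∧ (a = Sum.inl 0 → Pbar.coeff j = 1) ∧
        (a = Sum.inr 0 → a₀' = Sum.inl 0 → Pbar.coeff 0 = 0) ∧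
        (a ≠ Sum.inl 0 → ¬(a = Sum.inr 0 ∧ a₀' = Sum.inl 0) →
          Pbar.coeff 0 = -∑ i ∈ Finset.Icc 1 (j : ℕ), Pbar.coeff i) ∧
        ∀ b, HamiltonJacobi (term 0 b) j a (dirBar a₀' a) Pbar x) := by
    intro j a x
    by_cases hx : x ∈ D
    swap
    · exact ⟨0, 0, fun h => absurd h hx⟩
    -- Both families consist of shifts `T_(a,c)` with `a ≠ c` and differ only in the choice of `c`,
    -- so `IsQuasiClassical.exists_symbol` covers both.
    obtain ⟨c, hc⟩ : ∃ c, c = if a = Sum.inl 0 then a₀ else Sum.inl 0 := ⟨_, rfl⟩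
    obtain ⟨c', hc'⟩ : ∃ c, c = if a = Sum.inr 0 then a₀' else Sum.inr 0 := ⟨_, rfl⟩
    have hac : a ≠ c := by
      rw [hc]
      split_ifs with h
      · rw [h]; exact ha₀.symm
      · exact h
    have hac' : a ≠ c' := by
      rw [hc']
      split_ifs with h
      · rw [h]; exact ha₀'.symm
      · exact h
    have hdir : dir a₀ a = shiftVec a c := by
      rw [dir, hc]; split_ifs <;> rfl
    have hdir' : dirBar a₀' a = shiftVec a c' := by
      rw [dirBar, hc']; split_ifs <;> rfl
    obtain ⟨P, h1, h2, h3, h4, -, h6⟩ := hphase.exists_symbol hD hε₀ hToda hac j hx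
    obtain ⟨P', h1', h2', h3', h4', h5', h6'⟩ := hphase.exists_symbol hD hε₀ hToda hac' j hx
    refine ⟨P, P', fun _ => ⟨⟨fun i => ?_, h2, h3, fun h => h4 h ?_, ?_⟩,
      fun i => ?_, h2', h3', fun h h' => h4' ?_ ?_, fun h h' => h5' h ?_, ?_⟩⟩
    · simp only [laxPlus_eq n₀ hc, hdir]
      exact h1 i
    · rw [hc, if_neg h]
    · rwa [hdir]
    · simp only [laxPlusBar_eq n₀ hc', hdir']
      exact h1' i
    · rw [h]; exact Sum.inr_ne_inl
    · rw [hc', if_pos h, h']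
    · rw [hc']
      split_ifs with h''
      · exact fun h3 => h' ⟨h'', h3⟩
      · exact Sum.inr_ne_inl
    · rwa [hdir']
  choose P Pbar hP using hex
  exact ⟨P, Pbar, fun j a x hx => hP j a x hx⟩
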